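/- Let $S$ be a saturated Hopf $C^*$-algebra: a $C^*$-algebra with a non-degenerate $*$-homomorphism $\delta:S\to M(S\otimes S)$ ($\otimes$ the minimal, i.e. spatial, tensor product, $M(\cdot)$ the multiplier algebra) such that $(\delta\otimes\mathrm{id})\delta=(\mathrm{id}\otimes\delta)\delta$, such that $\delta(s)(1\otimes t)$ and $\delta(s)(t\otimes 1)$ lie in $S\otimes S$ for all $s,t\in S$, and such that the linear spans of $\{\delta(s)(1\otimes t):s,t\in S\}$ and of $\{\delta(s)(t\otimes 1):s,t\in S\}$ are dense in $S\otimes S$. Let the dual Banach space $S^*$ carry the product $fg=(f\otimes g)\delta$, where $f\otimes g$ is extended canonically to $M(S\otimes S)$. Let $A$ be a left Hopf ideal of $S^*$, i.e. a non-zero linear subspace with $fg\in A$ for all $f\in S^*$, $g\in A$, which is $S$-invariant: for all $f\in A$ and $s\in S$ the functionals $t\mapsto f(ts)$ and $t\mapsto f(st)$ belong to $A$. Then the following are equivalent: (1) $S^*$ has a two-sided identity and $A$ is $\sigma(S^*,S)$-dense in $S^*$; (2) $A$ has a bounded left $\sigma(S^*,S)$-approximate identity: there is a norm-bounded net $(e_i)$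 in $A$ such that $(e_if)(s)\to f(s)$ for all $f\in A$ and $s\in S$. -/

import Mathlib

open scoped InnerProductSpace TensorProduct MultiplierAlgebra Topology
open Filter
universe u v


namespace HopfCStar

noncomputable section Multipliers

variable {C : Type*} [NonUnitalCStarAlgebra C]
variable {K : Type*} [NormedAddCommGroup K] [InnerProductSpace ℂ K] [CompleteSpace K]

/-- The canonical approximate unit of a C⋆-algebra, as a filter. -/
def approxUnit (C : Type*) [NonUnitalCStarAlgebra C] : Filter C :=
  letI := CStarAlgebra.spectralOrder C
  letI := CStarAlgebra.spectralOrderedRing C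
  CStarAlgebra.approximateUnit C

theorem approxUnit_isApproximateUnit : (approxUnit C).IsApproximateUnit := by
  let _ := CStarAlgebra.spectralOrder C
  let _ := CStarAlgebra.spectralOrderedRing C
  exact (CStarAlgebra.increasingApproximateUnit C).toIsApproximateUnit

instance approxUnit_neBot : (approxUnit C).NeBot := approxUnit_isApproximateUnit.neBot

theorem approxUnit_norm : ∀ᶠ e in approxUnit C, ‖e‖ ≤ 1 := by
  let _ := CStarAlgebra.spectralOrder C
  let _ := CStarAlgebra.spectralOrderedRing C
  exact (CStarAlgebra.increasingApproximateUnit C).eventually_norm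

theorem approxUnit_star : ∀ᶠ e in approxUnit C, star e = e := by
  let _ := CStarAlgebra.spectralOrder C
  let _ := CStarAlgebra.spectralOrderedRing C
  exact (CStarAlgebra.increasingApproximateUnit C).eventually_star_eq

theorem tendsto_mul_approxUnit (c : C) : Tendsto (fun e => c * e) (approxUnit C) (𝓝 c) :=
  approxUnit_isApproximateUnit.tendsto_mul_left c

theorem tendsto_approxUnit_mul (c : C) : Tendsto (fun e => e * c) (approxUnit C) (𝓝 c) :=
  approxUnit_isApproximateUnit.tendsto_mul_right c

theorem fst_mul (m : 𝓜(ℂ, C)) (x y : C) : m.fst (x * y) = m.fst x * y := by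
  have h : ∀ z : C, z * (m.fst (x * y) - m.fst x * y) = 0 := by
    intro z
    rw [mul_sub, ← m.central, ← mul_assoc, ← mul_assoc, m.central, sub_self]
  have := h (star (m.fst (x * y) - m.fst x * y))
  rw [CStarRing.star_mul_self_eq_zero_iff] at this
  exact sub_eq_zero.mp this

theorem norm_fst_apply_le (m : 𝓜(ℂ, C)) (x : C) : ‖m.fst x‖ ≤ ‖m‖ * ‖x‖ := by
  rw [← DoubleCentralizer.norm_fst]; exact m.fst.le_opNorm x

/-! ### Strict extension of bounded functionals -/

theorem exists_norm_sub_mul_le (F : StrongDual ℂ C) {ε : ℝ} (hε : 0 < ε) :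
    ∃ e : C, ∀ c, ‖F (c - e * c)‖ ≤ ε * ‖c‖ := by
  obtain ⟨t, ht⟩ : ∃ t, t = ε / (6 * (‖F‖ + 1)) := ⟨_, rfl⟩
  have hM := norm_nonneg F
  have ht0 : 0 < t := by rw [ht]; positivity
  have htε : 6 * (‖F‖ + 1) * t = ε := by rw [ht]; field_simp
  obtain ⟨x, hx1, hx⟩ := F.exists_lt_apply_of_lt_opNorm
    (show ‖F‖ - t * ε / 2 < ‖F‖ by linarith [mul_pos ht0 hε])
  obtain ⟨e, hex, hen, hes⟩ := (((Metric.tendsto_nhds.mp (tendsto_approxUnit_mul x)) t ht0).and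
    (approxUnit_norm.and approxUnit_star)).exists
  have unit : ∀ c, ‖c‖ ≤ 1 → ‖F (c - e * c)‖ ≤ ε := by
    intro c hc
    obtain ⟨d, hd⟩ : ∃ d, d = c - e * c := ⟨_, rfl⟩
    rw [← hd]
    have hec : ‖e * c‖ ≤ 1 := (norm_mul_le _ _).trans (by nlinarith [norm_nonneg c, norm_nonneg e])
    have hd2 : ‖d‖ ≤ 2 := by rw [hd]; exact (norm_sub_le _ _).trans (by linarith)
    have hxd : ‖star x * d‖ ≤ t := by
      have h : star x * d = star (x - e * x) * c := by
        rw [hd, star_sub, star_mul, hes, mul_sub, sub_mul, mul_assoc]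
      rw [h]
      refine (norm_mul_le _ _).trans ?_
      rw [dist_eq_norm, norm_sub_rev] at hex
      rw [norm_star]
      nlinarith [norm_nonneg c, norm_nonneg (x - e * x)]
    obtain ⟨u, hu, hu'⟩ := Complex.exists_norm_eq_mul_self (F x)
    obtain ⟨v, hv, hv'⟩ := Complex.exists_norm_eq_mul_self (F d)
    obtain ⟨y, hy⟩ : ∃ y, y = u • x := ⟨_, rfl⟩
    obtain ⟨w, hw⟩ : ∃ w, w = ((t : ℂ) * v) • d := ⟨_, rfl⟩
    have hFz : F (y + w) = ((‖F x‖ + t * ‖F d‖ : ℝ) : ℂ) := by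
      push_cast
      rw [hu', hv', hy, hw, map_add, map_smul, map_smul, smul_eq_mul, smul_eq_mul, mul_assoc]
    have hz1 : ‖F x‖ + t * ‖F d‖ ≤ ‖F‖ * ‖y + w‖ := by
      have := F.le_opNorm (y + w)
      rw [hFz, Complex.norm_real, Real.norm_of_nonneg (by positivity)] at this
      exact this
    have hy1 : ‖y‖ ≤ 1 := by rw [hy, norm_smul, hu]; linarith
    have hw1 : ‖w‖ ≤ 2 * t := by
      rw [hw, norm_smul, norm_mul, hv, Complex.norm_real, Real.norm_of_nonneg ht0.le]
      nlinarith
    have hyw : ‖star y * w‖ ≤ t * t := by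
      rw [hy, hw, star_smul, smul_mul_smul_comm, norm_smul, norm_mul, norm_star, hu, norm_mul, hv,
        Complex.norm_real, Real.norm_of_nonneg ht0.le]
      nlinarith
    have hz2 : ‖y + w‖ ^ 2 ≤ 1 + 2 * (t * t) + 4 * (t * t) := by
      have h1 : star (y + w) * (y + w) = star y * y + star y * w + star (star y * w) +
          star w * w := by
        simp only [star_add, star_mul, star_star]; noncomm_ring
      rw [sq, ← CStarRing.norm_star_mul_self, h1]
      have h2 : ‖star y * y‖ ≤ 1 := by
        rw [CStarRing.norm_star_mul_self]; nlinarith [norm_nonneg y]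
      have h3 : ‖star w * w‖ ≤ 4 * (t * t) := by
        rw [CStarRing.norm_star_mul_self]; nlinarith [norm_nonneg w]
      have h4 : ‖star (star y * w)‖ ≤ t * t := by rwa [norm_star]
      have := norm_add₄_le (a := star y * y) (b := star y * w) (c := star (star y * w))
        (d := star w * w)
      linarith
    have hz3 : ‖y + w‖ ≤ 1 + 3 * (t * t) := by
      nlinarith [norm_nonneg (y + w), mul_pos ht0 ht0]
    have h5 : t * ‖F d‖ ≤ t * ε := by
      have : ‖F‖ * ‖y + w‖ ≤ ‖F‖ * (1 + 3 * (t * t)) := mul_le_mul_of_nonneg_left hz3 hM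
      nlinarith [mul_pos ht0 ht0]
    exact le_of_mul_le_mul_left h5 ht0
  refine ⟨e, fun c => ?_⟩
  rcases eq_or_ne c 0 with rfl | hc
  · simp
  have hc' : 0 < ‖c‖ := norm_pos_iff.mpr hc
  have h := unit (((‖c‖⁻¹ : ℝ) : ℂ) • c) (by simp [norm_smul, hc'.ne'])
  rw [mul_smul_comm, ← smul_sub, map_smul, norm_smul, Complex.norm_real, norm_inv, norm_norm,
    inv_mul_le_iff₀ hc'] at h
  linarith

theorem exists_strict_limit (F : StrongDual ℂ C) (m : 𝓜(ℂ, C)) :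
    ∃ z : ℂ, Tendsto (fun e => F (m.fst e)) (approxUnit C) (𝓝 z) := by
  apply cauchy_map_iff_exists_tendsto.mp
  rw [Metric.cauchy_iff]
  refine ⟨inferInstance, fun ε hε => ?_⟩
  obtain ⟨e₀, he₀⟩ := exists_norm_sub_mul_le F (ε := ε / (4 * (‖m‖ + 1))) (by positivity)
  have h1 : Tendsto (fun e => F (e₀ * m.fst e)) (approxUnit C) (𝓝 (F (m.snd e₀))) := by
    simp_rw [← m.central]
    exact (F.continuous.tendsto _).comp (tendsto_mul_approxUnit _)
  have h2 := (Metric.tendsto_nhds.mp h1) (ε / 4) (by positivity)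
  refine ⟨Metric.ball (F (m.snd e₀)) (ε / 2), ?_, ?_⟩
  · rw [mem_map]
    filter_upwards [h2, approxUnit_norm] with e he hn
    simp only [Set.mem_preimage, Metric.mem_ball] at he ⊢
    have h3 := he₀ (m.fst e)
    have h4 : ‖m.fst e‖ ≤ ‖m‖ := by
      refine (norm_fst_apply_le m e).trans ?_
      nlinarith [norm_nonneg m]
    have h5 : ‖F (m.fst e) - F (e₀ * m.fst e)‖ ≤ ε / 4 := by
      rw [← map_sub]
      refine h3.trans ?_
      rw [div_mul_eq_mul_div, div_le_div_iff₀ (by positivity) (by norm_num)]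
      nlinarith [norm_nonneg m]
    rw [← dist_eq_norm] at h5
    linarith [dist_triangle (F (m.fst e)) (F (e₀ * m.fst e)) (F (m.snd e₀))]
  · intro x hx y hy
    have := dist_triangle_right x y (F (m.snd e₀))
    simp only [Metric.mem_ball] at hx hy
    linarith

/-- The canonical (strictly continuous) extension of a bounded functional `F` on a C⋆-algebra
to its multiplier algebra: `m ↦ lim F (m e)`, with `e` running through the approximate unit. -/
def strictExt (F : StrongDual ℂ C) : StrongDual ℂ 𝓜(ℂ, C) :=
  LinearMap.mkContinuous
    { toFun := fun m => (exists_strict_limit F m).choose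
      map_add' := fun m n => by
        refine tendsto_nhds_unique (exists_strict_limit F (m + n)).choose_spec ?_
        simpa using (exists_strict_limit F m).choose_spec.add (exists_strict_limit F n).choose_spec
      map_smul' := fun r m => by
        refine tendsto_nhds_unique (exists_strict_limit F (r • m)).choose_spec ?_
        simpa using (exists_strict_limit F m).choose_spec.const_mul r }
    ‖F‖ (fun m => by
      refine le_of_tendsto (exists_strict_limit F m).choose_spec.norm ?_
      filter_upwards [approxUnit_norm] with e he
      refine (F.le_opNorm _).trans ?_
      gcongr
      refine (norm_fst_apply_le m e).trans ?_
      nlinarith [norm_nonneg m])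

theorem tendsto_strictExt (F : StrongDual ℂ C) (m : 𝓜(ℂ, C)) :
    Tendsto (fun e => F (m.fst e)) (approxUnit C) (𝓝 (strictExt F m)) :=
  (exists_strict_limit F m).choose_spec

/-! ### Extension of representations -/

theorem norm_hom_le (θ : C →⋆ₙₐ[ℂ] (K →L[ℂ] K)) (c : C) : ‖θ c‖ ≤ ‖c‖ :=
  NonUnitalStarAlgHom.norm_apply_le θ c

/-- To check a closed linear condition on a Hilbert space carrying a representation `θ`, it is
enough to consider vectors `θ c k` and vectors killed by `θ`. -/
theorem mem_of_essential (θ : C →⋆ₙₐ[ℂ] (K →L[ℂ] K)) (V : Submodule ℂ K)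
    (hV : IsClosed (V : Set K)) (h1 : ∀ c k, θ c k ∈ V) (h2 : ∀ k, (∀ c, θ c k = 0) → k ∈ V)
    (k : K) : k ∈ V := by
  have : CompleteSpace V := hV.completeSpace_coe
  have hk : ∀ k ∈ Vᗮ, ∀ c, θ c k = 0 := by
    intro k hk c
    have : ⟪θ (star c) (θ c k), k⟫_ℂ = 0 := (Submodule.mem_orthogonal V k).mp hk _ (h1 _ _)
    rw [map_star, ContinuousLinearMap.star_eq_adjoint, ContinuousLinearMap.adjoint_inner_left,
      inner_self_eq_zero] at this
    exact this
  obtain ⟨y, hy, z, hz, rfl⟩ := V.exists_add_mem_mem_orthogonal k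
  exact V.add_mem hy (h2 z (hk z hz))

theorem exists_strong_limit (θ : C →⋆ₙₐ[ℂ] (K →L[ℂ] K)) (m : 𝓜(ℂ, C)) (k : K) :
    ∃ l : K, Tendsto (fun e => θ (m.fst e) k) (approxUnit C) (𝓝 l) := by
  let V : Submodule ℂ K :=
    { carrier := {k | ∃ l : K, Tendsto (fun e => θ (m.fst e) k) (approxUnit C) (𝓝 l)}
      add_mem' := by
        rintro a b ⟨l, hl⟩ ⟨l', hl'⟩
        exact ⟨l + l', by simpa using hl.add hl'⟩
      zero_mem' := ⟨0, by simp⟩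
      smul_mem' := by
        rintro r a ⟨l, hl⟩
        exact ⟨r • l, by simpa using hl.const_smul r⟩ }
  refine mem_of_essential θ V ?_ ?_ ?_ k
  · rw [← closure_subset_iff_isClosed]
    intro x hx
    apply cauchy_map_iff_exists_tendsto.mp
    rw [Metric.cauchy_iff]
    refine ⟨inferInstance, fun ε hε => ?_⟩
    obtain ⟨y, ⟨l, hl⟩, hxy⟩ := Metric.mem_closure_iff.mp hx (ε / (4 * (‖m‖ + 1))) (by positivity)
    refine ⟨Metric.ball l (ε / 2), ?_, ?_⟩
    · rw [mem_map]
      filter_upwards [(Metric.tendsto_nhds.mp hl) (ε / 4) (by positivity), approxUnit_norm]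
        with e he hn
      simp only [Set.mem_preimage, Metric.mem_ball] at he ⊢
      have h4 : ‖θ (m.fst e)‖ ≤ ‖m‖ := by
        refine (norm_hom_le θ _).trans ((norm_fst_apply_le m e).trans ?_)
        nlinarith [norm_nonneg m]
      have h5 : ‖θ (m.fst e) x - θ (m.fst e) y‖ ≤ ε / 4 := by
        rw [← map_sub]
        refine ((θ (m.fst e)).le_of_opNorm_le h4 _).trans ?_
        rw [dist_eq_norm, lt_div_iff₀ (by positivity)] at hxy
        nlinarith [norm_nonneg m, norm_nonneg (x - y)]
      rw [← dist_eq_norm] at h5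
      linarith [dist_triangle (θ (m.fst e) x) (θ (m.fst e) y) l]
    · intro a ha b hb
      have := dist_triangle_right a b l
      simp only [Metric.mem_ball] at ha hb
      linarith
  · intro c k
    refine ⟨θ (m.fst c) k, ?_⟩
    have h := tendsto_approxUnit_mul c
    have h' : Tendsto (fun e => θ (m.fst (e * c)) k) (approxUnit C) (𝓝 (θ (m.fst c) k)) := by
      have hc : Continuous fun x => θ (m.fst x) k := by
        have : Continuous θ := AddMonoidHomClass.continuous_of_bound θ 1 (by simpa using norm_hom_le θ)
        fun_prop
      exact (hc.tendsto _).comp h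
    simpa [fst_mul] using h'
  · intro k hk
    exact ⟨0, by simp [hk]⟩

/-- The strong operator limit `lim θ (m e)`, with `e` running through the approximate unit. -/
def repExtApply (θ : C →⋆ₙₐ[ℂ] (K →L[ℂ] K)) (m : 𝓜(ℂ, C)) : K →L[ℂ] K :=
  LinearMap.mkContinuous
    { toFun := fun k => (exists_strong_limit θ m k).choose
      map_add' := fun k l => by
        refine tendsto_nhds_unique (exists_strong_limit θ m (k + l)).choose_spec ?_
        simpa using (exists_strong_limit θ m k).choose_spec.add
          (exists_strong_limit θ m l).choose_spec
      map_smul' := fun r k => by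
        refine tendsto_nhds_unique (exists_strong_limit θ m (r • k)).choose_spec ?_
        simpa using (exists_strong_limit θ m k).choose_spec.const_smul r }
    ‖m‖ (fun k => by
      refine le_of_tendsto (exists_strong_limit θ m k).choose_spec.norm ?_
      filter_upwards [approxUnit_norm] with e he
      refine (θ (m.fst e)).le_of_opNorm_le ?_ k
      refine (norm_hom_le θ _).trans ((norm_fst_apply_le m e).trans ?_)
      nlinarith [norm_nonneg m])

theorem tendsto_repExtApply (θ : C →⋆ₙₐ[ℂ] (K →L[ℂ] K)) (m : 𝓜(ℂ, C)) (k : K) :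
    Tendsto (fun e => θ (m.fst e) k) (approxUnit C) (𝓝 (repExtApply θ m k)) :=
  (exists_strong_limit θ m k).choose_spec

theorem repExtApply_apply_hom (θ : C →⋆ₙₐ[ℂ] (K →L[ℂ] K)) (m : 𝓜(ℂ, C)) (c : C) (k : K) :
    repExtApply θ m (θ c k) = θ (m.fst c) k := by
  refine tendsto_nhds_unique (tendsto_repExtApply θ m (θ c k)) ?_
  have hc : Continuous fun x => θ (m.fst x) k := by
    have : Continuous θ := AddMonoidHomClass.continuous_of_bound θ 1 (by simpa using norm_hom_le θ)
    fun_prop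
  have h : Tendsto (fun e => θ (m.fst (e * c)) k) (approxUnit C) (𝓝 (θ (m.fst c) k)) :=
    (hc.tendsto _).comp (tendsto_approxUnit_mul c)
  simpa [fst_mul] using h

theorem repExtApply_of_forall_eq_zero (θ : C →⋆ₙₐ[ℂ] (K →L[ℂ] K)) (m : 𝓜(ℂ, C)) (k : K)
    (hk : ∀ c, θ c k = 0) : repExtApply θ m k = 0 :=
  tendsto_nhds_unique (tendsto_repExtApply θ m k) (by simp [hk])

theorem eq_of_essential (θ : C →⋆ₙₐ[ℂ] (K →L[ℂ] K)) {L : Type*} [NormedAddCommGroup L]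
    [InnerProductSpace ℂ L] (X Y : K →L[ℂ] L)
    (h1 : ∀ c k, X (θ c k) = Y (θ c k)) (h2 : ∀ k, (∀ c, θ c k = 0) → X k = Y k) : X = Y := by
  ext k
  exact mem_of_essential θ (LinearMap.eqLocus X.toLinearMap Y.toLinearMap)
    (isClosed_eq X.continuous Y.continuous) h1 h2 k

/-- The canonical extension of a representation `θ` of a C⋆-algebra on a Hilbert space to the
multiplier algebra; it is determined by `repExt θ m * θ c = θ (m c)` and by being zero on the
vectors killed by `θ` (there are none but `0` if `θ` is non-degenerate). -/
def repExt (θ : C →⋆ₙₐ[ℂ] (K →L[ℂ] K)) : 𝓜(ℂ, C) →⋆ₙₐ[ℂ] (K →L[ℂ] K) where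
  toFun := repExtApply θ
  map_smul' r m := by
    refine eq_of_essential θ _ _ (fun c k => ?_) (fun k hk => ?_)
    · simp [repExtApply_apply_hom]
    · simp [repExtApply_of_forall_eq_zero θ _ k hk]
  map_zero' := by
    refine eq_of_essential θ _ _ (fun c k => ?_) (fun k hk => ?_)
    · simp [repExtApply_apply_hom]
    · simp [repExtApply_of_forall_eq_zero θ _ k hk]
  map_add' m n := by
    refine eq_of_essential θ _ _ (fun c k => ?_) (fun k hk => ?_)
    · simp [repExtApply_apply_hom]
    · simp [repExtApply_of_forall_eq_zero θ _ k hk]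
  map_mul' m n := by
    refine eq_of_essential θ _ _ (fun c k => ?_) (fun k hk => ?_)
    · simp [repExtApply_apply_hom]
    · simp [repExtApply_of_forall_eq_zero θ _ k hk]
  map_star' m := by
    rw [ContinuousLinearMap.star_eq_adjoint]
    refine (ContinuousLinearMap.eq_adjoint_iff _ _).mpr fun l k => ?_
    have key : innerSL ℂ k ∘L repExtApply θ (star m) =
        innerSL ℂ (repExtApply θ m k) := by
      refine eq_of_essential θ _ _ (fun d l => ?_) (fun l hl => ?_)
      · simp only [ContinuousLinearMap.comp_apply, innerSL_apply_apply, repExtApply_apply_hom]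
        refine tendsto_nhds_unique (f := fun e => ⟪θ (m.fst e) k, θ d l⟫_ℂ) ?_
          ((tendsto_repExtApply θ m k).inner tendsto_const_nhds)
        have h1 : ∀ e, ⟪θ (m.fst e) k, θ d l⟫_ℂ = ⟪k, θ (star e * (star m).fst d) l⟫_ℂ := by
          intro e
          rw [← ContinuousLinearMap.adjoint_inner_right, ← ContinuousLinearMap.star_eq_adjoint,
            ← map_star, ← mul_apply_eq_comp, ← map_mul]
          congr 3
          rw [DoubleCentralizer.star_fst, ← star_mul, m.central]
          simp
        simp_rw [h1]
        have hc : Continuous fun x => ⟪k, θ x l⟫_ℂ := by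
          have : Continuous θ :=
            AddMonoidHomClass.continuous_of_bound θ 1 (by simpa using norm_hom_le θ)
          fun_prop
        refine ((hc.tendsto _).comp (tendsto_approxUnit_mul ((star m).fst d))).congr' ?_
        filter_upwards [approxUnit_star] with e he
        simp [he]
      · simp only [ContinuousLinearMap.comp_apply, innerSL_apply_apply,
          repExtApply_of_forall_eq_zero θ _ l hl, inner_zero_right]
        refine tendsto_nhds_unique (f := fun e => ⟪θ (m.fst e) k, l⟫_ℂ) ?_
          ((tendsto_repExtApply θ m k).inner tendsto_const_nhds)
        have h1 : ∀ e, ⟪θ (m.fst e) k, l⟫_ℂ = 0 := by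
          intro e
          rw [← ContinuousLinearMap.adjoint_inner_right, ← ContinuousLinearMap.star_eq_adjoint,
            ← map_star, hl, inner_zero_right]
        simp [h1]
    have := congr(starRingEnd ℂ ($key l))
    simpa using this

theorem repExt_apply_hom (θ : C →⋆ₙₐ[ℂ] (K →L[ℂ] K)) (m : 𝓜(ℂ, C)) (c : C) (k : K) :
    repExt θ m (θ c k) = θ (m.fst c) k := repExtApply_apply_hom θ m c k

end Multipliers

noncomputable section SpatialTensor

variable {H K : Type*} [NormedAddCommGroup H] [InnerProductSpace ℂ H] [CompleteSpace H]
  [NormedAddCommGroup K] [InnerProductSpace ℂ K] [CompleteSpace K]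

/-- The Hilbert space tensor product (completion of the algebraic one). -/
def HilbertTensor (H K : Type*) [NormedAddCommGroup H] [InnerProductSpace ℂ H]
    [NormedAddCommGroup K] [InnerProductSpace ℂ K] : Type _ :=
  UniformSpace.Completion (H ⊗[ℂ] K)

instance : NormedAddCommGroup (HilbertTensor H K) :=
  inferInstanceAs (NormedAddCommGroup (UniformSpace.Completion (H ⊗[ℂ] K)))

instance : InnerProductSpace ℂ (HilbertTensor H K) :=
  inferInstanceAs (InnerProductSpace ℂ (UniformSpace.Completion (H ⊗[ℂ] K)))

instance : CompleteSpace (HilbertTensor H K) :=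
  inferInstanceAs (CompleteSpace (UniformSpace.Completion (H ⊗[ℂ] K)))

/-- The inclusion of the algebraic into the Hilbert space tensor product. -/
def HilbertTensor.of : H ⊗[ℂ] K →ₗᵢ[ℂ] HilbertTensor H K :=
  UniformSpace.Completion.toComplₗᵢ

theorem HilbertTensor.denseRange_of :
    DenseRange (HilbertTensor.of : H ⊗[ℂ] K →ₗᵢ[ℂ] HilbertTensor H K) :=
  UniformSpace.Completion.denseRange_coe

/-- The elementary tensor `ξ ⊗ η` in the Hilbert space tensor product. -/
def vec (ξ : H) (η : K) : HilbertTensor H K := HilbertTensor.of (ξ ⊗ₜ[ℂ] η)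

/-- The tensor product `X ⊗ Y` of two bounded operators, acting on the Hilbert space tensor
product. -/
def opTensor (X : H →L[ℂ] H) (Y : K →L[ℂ] K) : HilbertTensor H K →L[ℂ] HilbertTensor H K :=
  (HilbertTensor.of.toContinuousLinearMap ∘L TensorProduct.mapL X Y).toLinearMap.extendOfNorm
    (HilbertTensor.of : H ⊗[ℂ] K →ₗᵢ[ℂ] HilbertTensor H K).toLinearMap

theorem opTensor_of (X : H →L[ℂ] H) (Y : K →L[ℂ] K) (z : H ⊗[ℂ] K) :
    opTensor X Y (HilbertTensor.of z) = HilbertTensor.of (TensorProduct.mapL X Y z) :=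
  LinearMap.extendOfNorm_eq
    (e := (HilbertTensor.of : H ⊗[ℂ] K →ₗᵢ[ℂ] HilbertTensor H K).toLinearMap)
    HilbertTensor.denseRange_of ⟨‖TensorProduct.mapL X Y‖, fun x => by
      simpa using (TensorProduct.mapL X Y).le_opNorm x⟩ z

theorem opTensor_vec (X : H →L[ℂ] H) (Y : K →L[ℂ] K) (ξ : H) (η : K) :
    opTensor X Y (vec ξ η) = vec (X ξ) (Y η) := by
  rw [vec, opTensor_of]; rfl

theorem inner_vec (ξ ξ' : H) (η η' : K) :
    ⟪vec ξ η, vec ξ' η'⟫_ℂ = ⟪ξ, ξ'⟫_ℂ * ⟪η, η'⟫_ℂ := by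
  simp [vec]

theorem norm_vec (ξ : H) (η : K) : ‖vec ξ η‖ = ‖ξ‖ * ‖η‖ := by
  simp [vec]

theorem opTensor_ext {L : Type*} [NormedAddCommGroup L] [NormedSpace ℂ L]
    {X Y : HilbertTensor H K →L[ℂ] L} (h : ∀ ξ η, X (vec ξ η) = Y (vec ξ η)) : X = Y := by
  ext z
  refine HilbertTensor.denseRange_of.induction_on z (isClosed_eq X.continuous Y.continuous)
    fun z => ?_
  induction z using TensorProduct.induction_on with
  | zero => simp
  | tmul ξ η => exact h ξ η
  | add x y hx hy => simp [hx, hy]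

theorem vec_add_left (ξ ξ' : H) (η : K) : vec (ξ + ξ') η = vec ξ η + vec ξ' η := by
  simp [vec, TensorProduct.add_tmul]

theorem vec_add_right (ξ : H) (η η' : K) : vec ξ (η + η') = vec ξ η + vec ξ η' := by
  simp [vec, TensorProduct.tmul_add]

theorem vec_smul_left (r : ℂ) (ξ : H) (η : K) : vec (r • ξ) η = r • vec ξ η := by
  rw [vec, ← TensorProduct.smul_tmul', map_smul]; rfl

theorem vec_smul_right (r : ℂ) (ξ : H) (η : K) : vec ξ (r • η) = r • vec ξ η := by
  simp [vec]

theorem opTensor_mul (X X' : H →L[ℂ] H) (Y Y' : K →L[ℂ] K) :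
    opTensor X Y * opTensor X' Y' = opTensor (X * X') (Y * Y') :=
  opTensor_ext fun ξ η => by simp [mul_apply_eq_comp, opTensor_vec]

theorem opTensor_star (X : H →L[ℂ] H) (Y : K →L[ℂ] K) :
    star (opTensor X Y) = opTensor (star X) (star Y) := by
  rw [ContinuousLinearMap.star_eq_adjoint, eq_comm, ContinuousLinearMap.eq_adjoint_iff]
  intro x y
  have : ∀ ξ η, innerSL ℂ (opTensor (star X) (star Y) (vec ξ η)) =
      innerSL ℂ (vec ξ η) ∘L opTensor X Y := by
    intro ξ η
    refine opTensor_ext fun ξ' η' => ?_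
    simp [opTensor_vec, inner_vec, ContinuousLinearMap.star_eq_adjoint,
      ContinuousLinearMap.adjoint_inner_left]
  have h2 : innerSL ℂ y ∘L opTensor (star X) (star Y) =
      innerSL ℂ (opTensor X Y y) := by
    refine opTensor_ext fun ξ η => ?_
    have := congr(starRingEnd ℂ ($(this ξ η) y))
    simpa using this
  simpa using congr(starRingEnd ℂ ($h2 x))

variable {S : Type*} [NonUnitalCStarAlgebra S]

/-- The operators `φ a ⊗ ψ b`, as a linear map on the algebraic tensor product. -/
def algTensor (φ : S →⋆ₙₐ[ℂ] (H →L[ℂ] H)) (ψ : S →⋆ₙₐ[ℂ] (K →L[ℂ] K)) :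
    S ⊗[ℂ] S →ₗ[ℂ] (HilbertTensor H K →L[ℂ] HilbertTensor H K) :=
  TensorProduct.lift <| LinearMap.mk₂ ℂ (fun a b => opTensor (φ a) (ψ b))
    (fun a a' b => opTensor_ext fun ξ η => by simp [opTensor_vec, vec_add_left])
    (fun r a b => opTensor_ext fun ξ η => by simp [opTensor_vec, vec_smul_left])
    (fun a b b' => opTensor_ext fun ξ η => by simp [opTensor_vec, vec_add_right])
    (fun r a b => opTensor_ext fun ξ η => by simp [opTensor_vec, vec_smul_right])

@[simp] theorem algTensor_tmul (φ : S →⋆ₙₐ[ℂ] (H →L[ℂ] H)) (ψ : S →⋆ₙₐ[ℂ] (K →L[ℂ] K))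
    (a b : S) : algTensor φ ψ (a ⊗ₜ b) = opTensor (φ a) (ψ b) := by
  simp [algTensor]

/-- The range of a linear map on the algebraic tensor product that is multiplicative and
`*`-preserving on elementary tensors. -/
def tensorRange {R : Type*} [NonUnitalCStarAlgebra R] (β : S ⊗[ℂ] S →ₗ[ℂ] R)
    (hm : ∀ a b c d, β (a ⊗ₜ b) * β (c ⊗ₜ d) = β ((a * c) ⊗ₜ (b * d)))
    (hs : ∀ a b, star (β (a ⊗ₜ b)) = β (star a ⊗ₜ star b)) : NonUnitalStarSubalgebra ℂ R where
  carrier := Set.range β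
  add_mem' := by rintro _ _ ⟨x, rfl⟩ ⟨y, rfl⟩; exact ⟨x + y, map_add _ _ _⟩
  zero_mem' := ⟨0, map_zero _⟩
  smul_mem' := by rintro r _ ⟨x, rfl⟩; exact ⟨r • x, map_smul _ _ _⟩
  mul_mem' := by
    rintro _ _ ⟨x, rfl⟩ ⟨y, rfl⟩
    change β x * β y ∈ LinearMap.range β
    induction x using TensorProduct.induction_on with
    | zero => simp
    | add x x' hx hx' => rw [map_add, add_mul]; exact add_mem hx hx'
    | tmul a b =>
      induction y using TensorProduct.induction_on with
      | zero => simp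
      | add y y' hy hy' => rw [map_add, mul_add]; exact add_mem hy hy'
      | tmul c d => exact ⟨_, (hm a b c d).symm⟩
  star_mem' := by
    rintro _ ⟨x, rfl⟩
    change star (β x) ∈ LinearMap.range β
    induction x using TensorProduct.induction_on with
    | zero => simp
    | add x x' hx hx' => rw [map_add, star_add]; exact add_mem hx hx'
    | tmul a b => exact ⟨_, (hs a b).symm⟩

theorem algTensor_mul (φ : S →⋆ₙₐ[ℂ] (H →L[ℂ] H)) (ψ : S →⋆ₙₐ[ℂ] (K →L[ℂ] K)) (a b c d : S) :
    algTensor φ ψ (a ⊗ₜ b) * algTensor φ ψ (c ⊗ₜ d) = algTensor φ ψ ((a * c) ⊗ₜ (b * d)) := by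
  simp [opTensor_mul]

theorem algTensor_star (φ : S →⋆ₙₐ[ℂ] (H →L[ℂ] H)) (ψ : S →⋆ₙₐ[ℂ] (K →L[ℂ] K)) (a b : S) :
    star (algTensor φ ψ (a ⊗ₜ b)) = algTensor φ ψ (star a ⊗ₜ star b) := by
  simp [opTensor_star, map_star]

/-- A faithful representation of a C⋆-algebra on a Hilbert space. -/
structure FaithfulRep (S : Type*) [NonUnitalCStarAlgebra S] (H : Type*) [NormedAddCommGroup H]
    [InnerProductSpace ℂ H] [CompleteSpace H] where
  /-- The representation. -/
  toHom : S →⋆ₙₐ[ℂ] (H →L[ℂ] H)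
  injective : Function.Injective toHom

/-- The spatial tensor product `S ⊗ S` as a C⋆-subalgebra of the bounded operators on `H ⊗ H`. -/
def minTensorSubalgebra (π : FaithfulRep S H) :
    NonUnitalStarSubalgebra ℂ (HilbertTensor H H →L[ℂ] HilbertTensor H H) :=
  (tensorRange (algTensor π.toHom π.toHom) (algTensor_mul _ _)
    (algTensor_star _ _)).topologicalClosure

/-- The spatial (minimal) C⋆-algebra tensor product `S ⊗ S`: the norm closure of the linear span
of the operators `π a ⊗ π b` on `H ⊗ H`, for a faithful representation `π` of `S` on `H`. -/
def MinTensor (π : FaithfulRep S H) : Type _ := minTensorSubalgebra π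

instance (π : FaithfulRep S H) : 
    IsClosed (minTensorSubalgebra π : Set (HilbertTensor H H →L[ℂ] HilbertTensor H H)) :=
  NonUnitalStarSubalgebra.isClosed_topologicalClosure _

instance (π : FaithfulRep S H) : NonUnitalCStarAlgebra (MinTensor π) :=
  inferInstanceAs (NonUnitalCStarAlgebra (minTensorSubalgebra π))

/-- The defining representation of `S ⊗ S` on `H ⊗ H`. -/
def MinTensor.incl (π : FaithfulRep S H) :
    MinTensor π →⋆ₙₐ[ℂ] (HilbertTensor H H →L[ℂ] HilbertTensor H H) :=
  NonUnitalStarSubalgebraClass.subtype (minTensorSubalgebra π)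

theorem MinTensor.incl_injective (π : FaithfulRep S H) : Function.Injective (MinTensor.incl π) :=
  Subtype.val_injective

theorem MinTensor.norm_incl (π : FaithfulRep S H) (x : MinTensor π) :
    ‖MinTensor.incl π x‖ = ‖x‖ := rfl

/-- The canonical map from the algebraic tensor product to `S ⊗ S`. -/
def MinTensor.ofAlg (π : FaithfulRep S H) : S ⊗[ℂ] S →ₗ[ℂ] MinTensor π where
  toFun x := ⟨algTensor π.toHom π.toHom x, subset_closure ⟨x, rfl⟩⟩
  map_add' _ _ := Subtype.ext (map_add _ _ _)
  map_smul' _ _ := Subtype.ext (map_smul _ _ _)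

@[simp] theorem MinTensor.incl_ofAlg (π : FaithfulRep S H) (x : S ⊗[ℂ] S) :
    MinTensor.incl π (MinTensor.ofAlg π x) = algTensor π.toHom π.toHom x := rfl

theorem MinTensor.denseRange_ofAlg (π : FaithfulRep S H) :
    DenseRange (MinTensor.ofAlg π) := by
  refine (Subtype.dense_iff
    (s := (minTensorSubalgebra π : Set (HilbertTensor H H →L[ℂ] HilbertTensor H H)))).mpr ?_
  intro x hx
  refine closure_mono ?_ hx
  rintro _ ⟨y, rfl⟩
  exact ⟨_, ⟨y, rfl⟩, rfl⟩

/-! ### Product functionals -/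

/-- The slice map `id ⊗ g` on the algebraic tensor product. -/
def sliceRight (g : StrongDual ℂ S) : S ⊗[ℂ] S →ₗ[ℂ] S :=
  TensorProduct.lift <| LinearMap.mk₂ ℂ (fun a b => g b • a)
    (fun _ _ _ => smul_add _ _ _) (fun _ _ _ => smul_comm _ _ _)
    (fun _ _ _ => by rw [map_add, add_smul]) (fun _ _ _ => by rw [map_smul, smul_assoc])

/-- The slice map `f ⊗ id` on the algebraic tensor product. -/
def sliceLeft (f : StrongDual ℂ S) : S ⊗[ℂ] S →ₗ[ℂ] S :=
  TensorProduct.lift <| LinearMap.mk₂ ℂ (fun a b => f a • b)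
    (fun _ _ _ => by rw [map_add, add_smul]) (fun _ _ _ => by rw [map_smul, smul_assoc])
    (fun _ _ _ => smul_add _ _ _) (fun _ _ _ => smul_comm _ _ _)

/-- The functional `f ⊗ g` on the algebraic tensor product, `a ⊗ b ↦ f a * g b`. -/
def algFunctional (f g : StrongDual ℂ S) : S ⊗[ℂ] S →ₗ[ℂ] ℂ :=
  f.toLinearMap ∘ₗ sliceRight g

@[simp] theorem algFunctional_tmul (f g : StrongDual ℂ S) (a b : S) :
    algFunctional f g (a ⊗ₜ b) = f a * g b := by
  simp [algFunctional, sliceRight, mul_comm]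

theorem algFunctional_eq (f g : StrongDual ℂ S) (x : S ⊗[ℂ] S) :
    algFunctional f g x = g (sliceLeft f x) := by
  have : algFunctional f g = g.toLinearMap ∘ₗ sliceLeft f := by
    ext a b; simp [sliceLeft]
  rw [this]; rfl

/-- The vector functional `a ↦ ⟪η, φ a ξ⟫`. -/
def vecFunctional (φ : S →⋆ₙₐ[ℂ] (H →L[ℂ] H)) (η ξ : H) : StrongDual ℂ S :=
  LinearMap.mkContinuous
    { toFun := fun a => ⟪η, φ a ξ⟫_ℂ
      map_add' := by simp
      map_smul' := by simp } (‖η‖ * ‖ξ‖) (fun a => by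
        refine (norm_inner_le_norm _ _).trans ?_
        rw [mul_assoc, mul_comm ‖ξ‖]
        gcongr
        exact (φ a).le_of_opNorm_le (norm_hom_le φ a) ξ)

@[simp] theorem vecFunctional_apply (φ : S →⋆ₙₐ[ℂ] (H →L[ℂ] H)) (η ξ : H) (a : S) :
    vecFunctional φ η ξ a = ⟪η, φ a ξ⟫_ℂ := rfl

theorem algFunctional_vec (φ : S →⋆ₙₐ[ℂ] (H →L[ℂ] H)) (ψ : S →⋆ₙₐ[ℂ] (K →L[ℂ] K))
    (η ξ : H) (η' ξ' : K) (x : S ⊗[ℂ] S) :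
    algFunctional (vecFunctional φ η ξ) (vecFunctional ψ η' ξ') x =
      ⟪vec η η', algTensor φ ψ x (vec ξ ξ')⟫_ℂ := by
  induction x using TensorProduct.induction_on with
  | zero => simp
  | tmul a b => simp [opTensor_vec, inner_vec]
  | add x y hx hy => simp [hx, hy]

theorem FaithfulRep.norm_le (π : FaithfulRep S H) (a : S) (M : ℝ) (hM : 0 ≤ M)
    (h : ∀ η ξ, ‖⟪η, π.toHom a ξ⟫_ℂ‖ ≤ M * (‖η‖ * ‖ξ‖)) : ‖a‖ ≤ M := by
  rw [← NonUnitalStarAlgHom.norm_map π.toHom π.injective]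
  refine ContinuousLinearMap.opNorm_le_bound _ hM fun ξ => ?_
  have := h (π.toHom a ξ) ξ
  rw [inner_self_eq_norm_sq_to_K, norm_pow, RCLike.norm_ofReal, abs_norm] at this
  rcases (norm_nonneg (π.toHom a ξ)).eq_or_lt with h0 | h0
  · rw [← h0]; positivity
  · nlinarith

theorem norm_algFunctional_le (π : FaithfulRep S H) (f g : StrongDual ℂ S) (x : S ⊗[ℂ] S) :
    ‖algFunctional f g x‖ ≤ ‖f‖ * ‖g‖ * ‖MinTensor.ofAlg π x‖ := by
  have h1 : ∀ η ξ, ‖algFunctional f (vecFunctional π.toHom η ξ) x‖ ≤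
      ‖f‖ * ‖MinTensor.ofAlg π x‖ * (‖η‖ * ‖ξ‖) := by
    intro η ξ
    have : ‖sliceRight (vecFunctional π.toHom η ξ) x‖ ≤
        ‖MinTensor.ofAlg π x‖ * (‖η‖ * ‖ξ‖) := by
      refine π.norm_le _ _ (by positivity) fun η' ξ' => ?_
      change ‖algFunctional (vecFunctional π.toHom η' ξ') (vecFunctional π.toHom η ξ) x‖ ≤ _
      rw [algFunctional_vec]
      refine (norm_inner_le_norm _ _).trans ?_
      have := (algTensor π.toHom π.toHom x).le_opNorm (vec ξ' ξ)
      rw [norm_vec] at this ⊢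
      change _ ≤ ‖MinTensor.ofAlg π x‖ * _ at this
      calc _ ≤ ‖η'‖ * ‖η‖ * (‖MinTensor.ofAlg π x‖ * (‖ξ'‖ * ‖ξ‖)) := by gcongr
        _ = _ := by ring
    refine (f.le_opNorm _).trans ?_
    rw [mul_assoc]
    gcongr
  have h2 : ‖sliceLeft f x‖ ≤ ‖f‖ * ‖MinTensor.ofAlg π x‖ := by
    refine π.norm_le _ _ (by positivity) fun η ξ => ?_
    have := h1 η ξ
    rwa [algFunctional_eq] at this
  rw [algFunctional_eq]
  calc _ ≤ ‖g‖ * (‖f‖ * ‖MinTensor.ofAlg π x‖) := (g.le_opNorm _).trans (by gcongr)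
    _ = _ := by ring

/-- The product functional `f ⊗ g` on the spatial tensor product `S ⊗ S`. -/
def tensorFunctional (π : FaithfulRep S H) (f g : StrongDual ℂ S) : StrongDual ℂ (MinTensor π) :=
  (algFunctional f g).extendOfNorm (MinTensor.ofAlg π)

theorem tensorFunctional_ofAlg (π : FaithfulRep S H) (f g : StrongDual ℂ S) (x : S ⊗[ℂ] S) :
    tensorFunctional π f g (MinTensor.ofAlg π x) = algFunctional f g x :=
  LinearMap.extendOfNorm_eq (MinTensor.denseRange_ofAlg π) ⟨_, norm_algFunctional_le π f g⟩ x

/-! ### Tensor products of representations -/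

variable {K₁ K₂ : Type*} [NormedAddCommGroup K₁] [InnerProductSpace ℂ K₁] [CompleteSpace K₁]
  [NormedAddCommGroup K₂] [InnerProductSpace ℂ K₂] [CompleteSpace K₂]

/-- The map `a ⊗ b ↦ (π a ⊗ π b, φ a ⊗ ψ b)` on the algebraic tensor product. -/
def pairTensor (π : FaithfulRep S H) (φ : S →⋆ₙₐ[ℂ] (K₁ →L[ℂ] K₁)) (ψ : S →⋆ₙₐ[ℂ] (K₂ →L[ℂ] K₂)) :
    S ⊗[ℂ] S →ₗ[ℂ] MinTensor π × (HilbertTensor K₁ K₂ →L[ℂ] HilbertTensor K₁ K₂) :=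
  (MinTensor.ofAlg π).prod (algTensor φ ψ)

/-- The closure of the set of pairs `(x, (φ ⊗ ψ) x)`, with `x` in the algebraic tensor product. -/
def graphTensor (π : FaithfulRep S H) (φ : S →⋆ₙₐ[ℂ] (K₁ →L[ℂ] K₁))
    (ψ : S →⋆ₙₐ[ℂ] (K₂ →L[ℂ] K₂)) : NonUnitalStarSubalgebra ℂ
      (MinTensor π × (HilbertTensor K₁ K₂ →L[ℂ] HilbertTensor K₁ K₂)) :=
  (tensorRange (pairTensor π φ ψ)
    (fun a b c d => Prod.ext (Subtype.ext (algTensor_mul _ _ a b c d)) (algTensor_mul _ _ a b c d))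
    (fun a b => Prod.ext (Subtype.ext (algTensor_star _ _ a b)) (algTensor_star _ _ a b))
    ).topologicalClosure

instance (π : FaithfulRep S H) (φ : S →⋆ₙₐ[ℂ] (K₁ →L[ℂ] K₁)) (ψ : S →⋆ₙₐ[ℂ] (K₂ →L[ℂ] K₂)) :
    IsClosed (graphTensor π φ ψ :
      Set (MinTensor π × (HilbertTensor K₁ K₂ →L[ℂ] HilbertTensor K₁ K₂))) :=
  NonUnitalStarSubalgebra.isClosed_topologicalClosure _

theorem graphTensor_fst (π : FaithfulRep S H) (φ : S →⋆ₙₐ[ℂ] (K₁ →L[ℂ] K₁))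
    (ψ : S →⋆ₙₐ[ℂ] (K₂ →L[ℂ] K₂)) (d) (hd : d ∈ graphTensor π φ ψ) (h0 : d.1 = 0) : d.2 = 0 := by
  have key : ∀ η ξ η' ξ', tensorFunctional π (vecFunctional φ η ξ) (vecFunctional ψ η' ξ') d.1 =
      ⟪vec η η', d.2 (vec ξ ξ')⟫_ℂ := by
    intro η ξ η' ξ'
    refine closure_minimal (s := Set.range (pairTensor π φ ψ))
      (t := {d | tensorFunctional π (vecFunctional φ η ξ) (vecFunctional ψ η' ξ') d.1 =
      ⟪vec η η', d.2 (vec ξ ξ')⟫_ℂ}) ?_ ?_ hd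
    · rintro _ ⟨x, rfl⟩
      change tensorFunctional π _ _ (MinTensor.ofAlg π x) = ⟪_, algTensor φ ψ x _⟫_ℂ
      rw [tensorFunctional_ofAlg, algFunctional_vec]
    · exact isClosed_eq (by fun_prop) (by fun_prop)
  refine opTensor_ext fun ξ ξ' => ?_
  rw [zero_apply, ← inner_self_eq_zero (𝕜 := ℂ)]
  have h : innerSL ℂ (d.2 (vec ξ ξ')) = 0 := by
    refine opTensor_ext fun η η' => ?_
    have := congr(starRingEnd ℂ $(key η ξ η' ξ'))
    rw [h0, map_zero, map_zero] at this
    simpa using this.symm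
  simpa using congr($h (d.2 (vec ξ ξ')))

theorem norm_algTensor_le (π : FaithfulRep S H) (φ : S →⋆ₙₐ[ℂ] (K₁ →L[ℂ] K₁))
    (ψ : S →⋆ₙₐ[ℂ] (K₂ →L[ℂ] K₂)) (x : S ⊗[ℂ] S) :
    ‖algTensor φ ψ x‖ ≤ ‖MinTensor.ofAlg π x‖ := by
  let p : graphTensor π φ ψ →⋆ₙₐ[ℂ] MinTensor π :=
    (NonUnitalStarAlgHom.fst ℂ _ _).comp (NonUnitalStarSubalgebraClass.subtype (graphTensor π φ ψ))
  have hp : Function.Injective p := by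
    rw [injective_iff_map_eq_zero]
    rintro ⟨d, hd⟩ h
    have h : d.1 = 0 := h
    exact Subtype.ext (Prod.ext h (graphTensor_fst π φ ψ d hd h))
  have h := NonUnitalStarAlgHom.norm_map p hp ⟨pairTensor π φ ψ x, subset_closure ⟨x, rfl⟩⟩
  calc ‖algTensor φ ψ x‖ ≤ ‖pairTensor π φ ψ x‖ := norm_snd_le (pairTensor π φ ψ x)
    _ = ‖MinTensor.ofAlg π x‖ := h.symm

theorem MinTensor.induction_on {π : FaithfulRep S H} {P : MinTensor π → Prop} (x : MinTensor π)
    (hc : IsClosed {x | P x}) (hadd : ∀ x y, P x → P y → P (x + y)) (h0 : P 0)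
    (h : ∀ a b, P (MinTensor.ofAlg π (a ⊗ₜ b))) : P x := by
  refine (MinTensor.denseRange_ofAlg π).induction_on x hc fun y => ?_
  induction y using TensorProduct.induction_on with
  | zero => simpa using h0
  | tmul a b => exact h a b
  | add x y hx hy => rw [map_add]; exact hadd _ _ hx hy

/-- The linear map underlying `tensorRep`. -/
def tensorRepAux (π : FaithfulRep S H) (φ : S →⋆ₙₐ[ℂ] (K₁ →L[ℂ] K₁))
    (ψ : S →⋆ₙₐ[ℂ] (K₂ →L[ℂ] K₂)) :
    MinTensor π →L[ℂ] (HilbertTensor K₁ K₂ →L[ℂ] HilbertTensor K₁ K₂) :=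
  (algTensor φ ψ).extendOfNorm (MinTensor.ofAlg π)

theorem tensorRepAux_ofAlg (π : FaithfulRep S H) (φ : S →⋆ₙₐ[ℂ] (K₁ →L[ℂ] K₁))
    (ψ : S →⋆ₙₐ[ℂ] (K₂ →L[ℂ] K₂)) (x : S ⊗[ℂ] S) :
    tensorRepAux π φ ψ (MinTensor.ofAlg π x) = algTensor φ ψ x :=
  LinearMap.extendOfNorm_eq (MinTensor.denseRange_ofAlg π)
    ⟨1, by simpa using norm_algTensor_le π φ ψ⟩ x

theorem MinTensor.ofAlg_mul (π : FaithfulRep S H) (a b c d : S) :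
    MinTensor.ofAlg π (a ⊗ₜ b) * MinTensor.ofAlg π (c ⊗ₜ d) =
      MinTensor.ofAlg π ((a * c) ⊗ₜ (b * d)) :=
  Subtype.ext (algTensor_mul _ _ a b c d)

theorem MinTensor.ofAlg_star (π : FaithfulRep S H) (a b : S) :
    star (MinTensor.ofAlg π (a ⊗ₜ b)) = MinTensor.ofAlg π (star a ⊗ₜ star b) :=
  Subtype.ext (algTensor_star _ _ a b)

/-- The tensor product `φ ⊗ ψ` of two representations of `S`, as a representation of the spatial
tensor product `S ⊗ S`. -/
def tensorRep (π : FaithfulRep S H) (φ : S →⋆ₙₐ[ℂ] (K₁ →L[ℂ] K₁))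
    (ψ : S →⋆ₙₐ[ℂ] (K₂ →L[ℂ] K₂)) :
    MinTensor π →⋆ₙₐ[ℂ] (HilbertTensor K₁ K₂ →L[ℂ] HilbertTensor K₁ K₂) where
  toFun := tensorRepAux π φ ψ
  map_smul' := map_smul _
  map_zero' := map_zero _
  map_add' := map_add _
  map_mul' x y := by
    induction x using MinTensor.induction_on with
    | hc => exact isClosed_eq (by fun_prop) (by fun_prop)
    | hadd x x' hx hx' => rw [add_mul, map_add, hx, hx', map_add, add_mul]
    | h0 => simp
    | h a b =>
      induction y using MinTensor.induction_on with
      | hc => exact isClosed_eq (by fun_prop) (by fun_prop)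
      | hadd x x' hx hx' => rw [mul_add, map_add, hx, hx', map_add, mul_add]
      | h0 => simp
      | h c d => rw [MinTensor.ofAlg_mul]; simp only [tensorRepAux_ofAlg, algTensor_mul]
  map_star' x := by
    induction x using MinTensor.induction_on with
    | hc => exact isClosed_eq (by fun_prop) (by fun_prop)
    | hadd x x' hx hx' => rw [star_add, map_add, hx, hx', map_add, star_add]
    | h0 => simp
    | h a b => rw [MinTensor.ofAlg_star]; simp only [tensorRepAux_ofAlg, algTensor_star]

theorem tensorRep_ofAlg (π : FaithfulRep S H) (φ : S →⋆ₙₐ[ℂ] (K₁ →L[ℂ] K₁))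
    (ψ : S →⋆ₙₐ[ℂ] (K₂ →L[ℂ] K₂)) (x : S ⊗[ℂ] S) :
    tensorRep π φ ψ (MinTensor.ofAlg π x) = algTensor φ ψ x :=
  tensorRepAux_ofAlg π φ ψ x

/-! ### The multipliers `s ⊗ 1` and `1 ⊗ t` -/

/-- An operator `X` on `H ⊗ H` with `X (S ⊗ S) ⊆ S ⊗ S` and `(S ⊗ S) X ⊆ S ⊗ S`, as a multiplier
of `S ⊗ S`. -/
def ofIdealizer (π : FaithfulRep S H) (X : HilbertTensor H H →L[ℂ] HilbertTensor H H)
    (hl : ∀ c : MinTensor π, ∃ d, MinTensor.incl π d = X * MinTensor.incl π c)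
    (hr : ∀ c : MinTensor π, ∃ d, MinTensor.incl π d = MinTensor.incl π c * X) :
    𝓜(ℂ, MinTensor π) where
  fst := LinearMap.mkContinuous
    { toFun := fun c => (hl c).choose
      map_add' := fun c d => MinTensor.incl_injective π (by
        rw [(hl (c + d)).choose_spec, map_add, map_add, (hl c).choose_spec, (hl d).choose_spec, mul_add])
      map_smul' := fun r c => MinTensor.incl_injective π (by
        rw [(hl (r • c)).choose_spec, map_smul, map_smul, (hl c).choose_spec, RingHom.id_apply,
          mul_smul_comm]) } ‖X‖ (fun c => by
        change ‖(hl c).choose‖ ≤ _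
        rw [← MinTensor.norm_incl, (hl c).choose_spec, ← MinTensor.norm_incl π c]
        exact norm_mul_le _ _)
  snd := LinearMap.mkContinuous
    { toFun := fun c => (hr c).choose
      map_add' := fun c d => MinTensor.incl_injective π (by
        rw [(hr (c + d)).choose_spec, map_add, map_add, (hr c).choose_spec, (hr d).choose_spec, add_mul])
      map_smul' := fun r c => MinTensor.incl_injective π (by
        rw [(hr (r • c)).choose_spec, map_smul, map_smul, (hr c).choose_spec, RingHom.id_apply,
          smul_mul_assoc]) } ‖X‖ (fun c => by
        change ‖(hr c).choose‖ ≤ _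
        rw [← MinTensor.norm_incl, (hr c).choose_spec, ← MinTensor.norm_incl π c, mul_comm ‖X‖]
        exact norm_mul_le _ _)
  central c d := MinTensor.incl_injective π (by
    change MinTensor.incl π ((hr c).choose * d) = MinTensor.incl π (c * (hl d).choose)
    rw [map_mul, map_mul, (hr c).choose_spec, (hl d).choose_spec, mul_assoc])

theorem incl_ofIdealizer_fst (π : FaithfulRep S H)
    (X : HilbertTensor H H →L[ℂ] HilbertTensor H H) (hl) (hr) (c : MinTensor π) :
    MinTensor.incl π ((ofIdealizer π X hl hr).fst c) = X * MinTensor.incl π c :=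
  (hl c).choose_spec

theorem incl_ofIdealizer_snd (π : FaithfulRep S H)
    (X : HilbertTensor H H →L[ℂ] HilbertTensor H H) (hl) (hr) (c : MinTensor π) :
    MinTensor.incl π ((ofIdealizer π X hl hr).snd c) = MinTensor.incl π c * X :=
  (hr c).choose_spec

/-- To map `S ⊗ S` into itself it is enough to do so on elementary tensors. -/
theorem exists_incl_eq (π : FaithfulRep S H)
    (T : (HilbertTensor H H →L[ℂ] HilbertTensor H H) →L[ℂ]
      (HilbertTensor H H →L[ℂ] HilbertTensor H H))
    (hT : ∀ a b, ∃ d, MinTensor.incl π d = T (opTensor (π.toHom a) (π.toHom b)))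
    (c : MinTensor π) : ∃ d, MinTensor.incl π d = T (MinTensor.incl π c) := by
  have hcont : Continuous (MinTensor.incl π) := continuous_subtype_val
  have hset : {x : MinTensor π | ∃ d, MinTensor.incl π d = T (MinTensor.incl π x)} =
      (fun x => T (MinTensor.incl π x)) ⁻¹' (minTensorSubalgebra π : Set (HilbertTensor H H →L[ℂ] HilbertTensor H H)) := by
    ext x
    exact ⟨fun ⟨d, hd⟩ => by rw [Set.mem_preimage, ← hd]; exact d.2, fun h => ⟨⟨_, h⟩, rfl⟩⟩
  induction c using MinTensor.induction_on with
  | hc =>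
    rw [hset]
    exact (NonUnitalStarSubalgebra.isClosed_topologicalClosure _).preimage
      (T.continuous.comp hcont)
  | hadd x y hx hy =>
    obtain ⟨d, hd⟩ := hx
    obtain ⟨e, he⟩ := hy
    exact ⟨d + e, by simp [hd, he]⟩
  | h0 => exact ⟨0, by simp⟩
  | h a b => simpa using hT a b

theorem continuous_incl (π : FaithfulRep S H) : Continuous (MinTensor.incl π) :=
  continuous_subtype_val

/-- The multiplier `s ⊗ 1` of `S ⊗ S`. -/
def leftLeg (π : FaithfulRep S H) (s : S) : 𝓜(ℂ, MinTensor π) :=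
  ofIdealizer π (opTensor (π.toHom s) 1)
    (exists_incl_eq π (ContinuousLinearMap.mul ℂ _ (opTensor (π.toHom s) 1)) fun a b =>
      ⟨MinTensor.ofAlg π ((s * a) ⊗ₜ b), by simp [opTensor_mul]⟩)
    (exists_incl_eq π ((ContinuousLinearMap.mul ℂ _).flip (opTensor (π.toHom s) 1)) fun a b =>
      ⟨MinTensor.ofAlg π ((a * s) ⊗ₜ b), by simp [opTensor_mul]⟩)

/-- The multiplier `1 ⊗ t` of `S ⊗ S`. -/
def rightLeg (π : FaithfulRep S H) (t : S) : 𝓜(ℂ, MinTensor π) :=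
  ofIdealizer π (opTensor 1 (π.toHom t))
    (exists_incl_eq π (ContinuousLinearMap.mul ℂ _ (opTensor 1 (π.toHom t))) fun a b =>
      ⟨MinTensor.ofAlg π (a ⊗ₜ (t * b)), by simp [opTensor_mul]⟩)
    (exists_incl_eq π ((ContinuousLinearMap.mul ℂ _).flip (opTensor 1 (π.toHom t))) fun a b =>
      ⟨MinTensor.ofAlg π (a ⊗ₜ (b * t)), by simp [opTensor_mul]⟩)

end SpatialTensor

noncomputable section Hopf

variable {S : Type u} [NonUnitalCStarAlgebra S]
  {H : Type v} [NormedAddCommGroup H] [InnerProductSpace ℂ H] [CompleteSpace H]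

/-- A `*`-homomorphism `δ : S → M(S ⊗ S)`, viewed as a representation of `S` on
`H ⊗ H` through the canonical representation of `M(S ⊗ S)`. -/
def coactionRep {π : FaithfulRep S H} (δ : S →⋆ₙₐ[ℂ] 𝓜(ℂ, MinTensor π)) :
    S →⋆ₙₐ[ℂ] (HilbertTensor H H →L[ℂ] HilbertTensor H H) :=
  (repExt (MinTensor.incl π)).comp δ

/-- The extension of `δ ⊗ id` to `M(S ⊗ S)`, with values in the operators on `(H ⊗ H) ⊗ H`. -/
def coactionTensorId {π : FaithfulRep S H} (δ : S →⋆ₙₐ[ℂ] 𝓜(ℂ, MinTensor π)) :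
    𝓜(ℂ, MinTensor π) →⋆ₙₐ[ℂ]
      (HilbertTensor (HilbertTensor H H) H →L[ℂ] HilbertTensor (HilbertTensor H H) H) :=
  repExt (tensorRep π (coactionRep δ) π.toHom)

/-- The extension of `id ⊗ δ` to `M(S ⊗ S)`, with values in the operators on `H ⊗ (H ⊗ H)`. -/
def idTensorCoaction {π : FaithfulRep S H} (δ : S →⋆ₙₐ[ℂ] 𝓜(ℂ, MinTensor π)) :
    𝓜(ℂ, MinTensor π) →⋆ₙₐ[ℂ]
      (HilbertTensor H (HilbertTensor H H) →L[ℂ] HilbertTensor H (HilbertTensor H H)) :=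
  repExt (tensorRep π π.toHom (coactionRep δ))

/-- The operators `X` on `(H ⊗ H) ⊗ H` and `Y` on `H ⊗ (H ⊗ H)` are the same operator under the
canonical unitary `(H ⊗ H) ⊗ H ≅ H ⊗ (H ⊗ H)`, expressed by their matrix coefficients at elementary
tensors (whose linear span is dense). -/
def AssocEq (X : HilbertTensor (HilbertTensor H H) H →L[ℂ] HilbertTensor (HilbertTensor H H) H)
    (Y : HilbertTensor H (HilbertTensor H H) →L[ℂ] HilbertTensor H (HilbertTensor H H)) : Prop :=
  ∀ ξ₁ ξ₂ ξ₃ η₁ η₂ η₃ : H,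
    ⟪vec (vec η₁ η₂) η₃, X (vec (vec ξ₁ ξ₂) ξ₃)⟫_ℂ =
      ⟪vec η₁ (vec η₂ η₃), Y (vec ξ₁ (vec ξ₂ ξ₃))⟫_ℂ

/-- A Hopf C⋆-algebra structure on a C⋆-algebra `S`, the spatial tensor products being formed by
means of the faithful representation `π`. -/
structure HopfCStarAlgebra (π : FaithfulRep S H) where
  /-- The comultiplication `δ : S → M(S ⊗ S)`. -/
  δ : S →⋆ₙₐ[ℂ] 𝓜(ℂ, MinTensor π)
  /-- Non-degeneracy: the linear span of `δ(S)(S ⊗ S)` is dense in `S ⊗ S`. -/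
  nondegenerate : Dense
    (Submodule.span ℂ {x : MinTensor π | ∃ s c, x = (δ s).fst c} : Set (MinTensor π))
  /-- Coassociativity: `(δ ⊗ id) δ = (id ⊗ δ) δ`. -/
  coassoc : ∀ s, AssocEq (coactionTensorId δ (δ s)) (idTensorCoaction δ (δ s))
  /-- `δ(S)(1 ⊗ S) ⊆ S ⊗ S`. -/
  mul_rightLeg_mem : ∀ s t, δ s * rightLeg π t ∈
    Set.range (DoubleCentralizer.coeHom : MinTensor π →⋆ₙₐ[ℂ] 𝓜(ℂ, MinTensor π))
  /-- `δ(S)(S ⊗ 1) ⊆ S ⊗ S`. -/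
  mul_leftLeg_mem : ∀ s t, δ s * leftLeg π t ∈
    Set.range (DoubleCentralizer.coeHom : MinTensor π →⋆ₙₐ[ℂ] 𝓜(ℂ, MinTensor π))

namespace HopfCStarAlgebra

variable {π : FaithfulRep S H} (𝒮 : HopfCStarAlgebra π)

/-- `S` is saturated: the linear spans of `δ(S)(1 ⊗ S)` and of `δ(S)(S ⊗ 1)` are dense in
`S ⊗ S`. -/
def IsSaturated : Prop :=
  Dense (Submodule.span ℂ {x : MinTensor π | ∃ s t,
      DoubleCentralizer.coeHom (𝕜 := ℂ) x = 𝒮.δ s * rightLeg π t} : Set (MinTensor π)) ∧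
  Dense (Submodule.span ℂ {x : MinTensor π | ∃ s t,
      DoubleCentralizer.coeHom (𝕜 := ℂ) x = 𝒮.δ s * leftLeg π t} : Set (MinTensor π))

/-- The product `f g = (f ⊗ g) δ` on the dual space `S*`. -/
def conv (f g : StrongDual ℂ S) : StrongDual ℂ S :=
  LinearMap.mkContinuous
    ((strictExt (tensorFunctional π f g)).toLinearMap ∘ₗ (𝒮.δ : S →ₗ[ℂ] 𝓜(ℂ, MinTensor π)))
    ‖strictExt (tensorFunctional π f g)‖
    (fun s => ((strictExt (tensorFunctional π f g)).le_opNorm _).trans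
      (mul_le_mul_of_nonneg_left (NonUnitalStarAlgHom.norm_apply_le 𝒮.δ s) (norm_nonneg _)))

theorem conv_apply (f g : StrongDual ℂ S) (s : S) :
    𝒮.conv f g s = strictExt (tensorFunctional π f g) (𝒮.δ s) := rfl

/-- The Banach algebra `S*` has a two-sided identity. -/
def DualIsUnital : Prop :=
  ∃ u : StrongDual ℂ S, ∀ f, 𝒮.conv u f = f ∧ 𝒮.conv f u = f

/-- `A` is a left Hopf ideal of `S*`: a non-zero left ideal of `S*` that is invariant under the
actions `f ↦ f(· s)` and `f ↦ f(s ·)` of `S`. -/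
structure IsLeftHopfIdeal (A : Submodule ℂ (StrongDual ℂ S)) : Prop where
  ne_bot : A ≠ ⊥
  left_ideal : ∀ f, ∀ g ∈ A, 𝒮.conv f g ∈ A
  invariant_left : ∀ f ∈ A, ∀ s : S, f ∘L (ContinuousLinearMap.mul ℂ S).flip s ∈ A
  invariant_right : ∀ f ∈ A, ∀ s : S, f ∘L ContinuousLinearMap.mul ℂ S s ∈ A

/-- `A` has a bounded left approximate identity for the weak topology `σ(S*, S)`: a norm bounded
net `e` in `A` with `e i * f → f` pointwise on `S`, for all `f ∈ A`. -/
def HasBoundedLeftWeakApproxIdentity (A : Submodule ℂ (StrongDual ℂ S)) : Prop :=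
  ∃ (ι : Type u) (_ : Preorder ι) (_ : IsDirectedOrder ι) (_ : Nonempty ι)
    (e : ι → StrongDual ℂ S), (∀ i, e i ∈ A) ∧ (∃ M : ℝ, ∀ i, ‖e i‖ ≤ M) ∧
      ∀ f ∈ A, Tendsto (fun i => StrongDual.toWeakDual (𝒮.conv (e i) f)) atTop
        (𝓝 (StrongDual.toWeakDual f))

end HopfCStarAlgebra
end Hopf
end HopfCStar

/-!
The argument works with the weak-* topology `σ(S*, S)` on `S*`, for which the product is separately
continuous: the slices `(id ⊗ g) δ(s)` and `(f ⊗ id) δ(s)` lie in `S`, because `g` and `f` are norm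
limits of functionals `g(t ·)` and `f(t ·)` and the products `(1 ⊗ t) δ(s)` and `(t ⊗ 1) δ(s)` lie
in `S ⊗ S` (`exists_conv_apply_eq_left`, `exists_conv_apply_eq_right`). Associativity of the product
(`conv_assoc_apply`) then only has to be checked on vector functionals of the faithful
representation, where it is the coassociativity of `δ` on Hilbert space.

If `A` has a bounded approximate identity, let `u` be a weak-* cluster point of it. Then `u g = g`
for `g ∈ A`, so `(f u - f) g = 0` for all `f ∈ S*` and `g ∈ A`. Since `A` is `S`-invariant and the
span of the `(1 ⊗ t) δ(s)` is dense, a functional `h` with `h A = 0` is zero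
(`eq_zero_of_conv_eq_zero`); hence `u` is a right identity. So every `f = f u` is a weak-* cluster
point of elements `f (e i)` of the left ideal `A`, which is therefore dense, and `u f = f` extends
from `A` to `S*`.

Conversely, let `u` be the identity of `S*` and let `A` be weak-* dense. A net in `A` that converges
to `u` is an approximate identity; the point is to find a bounded one. An `S`-invariant subspace
that separates the points of `S` is automatically norming (`norm_le_of_invariant_of_separating`),
by a localisation argument in the functional calculus, and by the Hahn-Banach theorem a norming
subspace contains bounded nets converging to any given functional
(`exists_mem_norm_le_of_norming`).
-/

namespace HopfCStar

/-! ### Invariant separating subspaces of the dual of a C⋆-algebra -/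

section Norming

variable {S : Type*} [NonUnitalCStarAlgebra S]

/-- For `a = s* s` of norm one, there is a non-zero `d` in the C⋆-algebra generated by `a` on which
multiplication by `a` is the identity up to multiplication by a small element. It is obtained from
a function supported near the point `1` of the spectrum of `a`. -/
theorem exists_mul_eq_add_mul (s : S) (hs : ‖s‖ = 1) {ε : ℝ} (hε : 0 < ε) (hε' : ε ≤ 1 / 2) :
    ∃ d k : S, d ≠ 0 ∧ ‖k‖ ≤ 2 * ε ∧ star s * s * d = d + k * d := by
  let _ := CStarAlgebra.spectralOrder S
  let _ := CStarAlgebra.spectralOrderedRing S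
  obtain ⟨a, ha⟩ : ∃ a, a = star s * s := ⟨_, rfl⟩
  have ha1 : ‖a‖ = 1 := by rw [ha, CStarRing.norm_star_mul_self, hs, mul_one]
  have ha0 : 0 ≤ a := ha ▸ star_mul_self_nonneg s
  have hsa : IsSelfAdjoint a := .of_nonneg ha0
  have hspec0 : ∀ t ∈ quasispectrum ℝ a, 0 ≤ t := quasispectrum_nonneg_of_nonneg a ha0
  have hspec1 : ∀ t ∈ quasispectrum ℝ a, t ≤ 1 := fun t ht => by
    have := NonUnitalIsometricContinuousFunctionalCalculus.norm_quasispectrum_le a ht hsa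
    rw [ha1, Real.norm_eq_abs] at this
    exact (abs_le.mp this).2
  rw [← ha]
  refine ⟨cfcₙ (fun t : ℝ => max 0 (t - (1 - ε))) a,
    cfcₙ (fun t : ℝ => max (-(2 * ε * t)) (t - 1)) a, ?_, ?_, ?_⟩
  · intro h0
    have hd : ∀ t ∈ quasispectrum ℝ a, t ≤ 1 - ε := by
      intro t ht
      have h1 := norm_apply_le_norm_cfcₙ (fun t : ℝ => max 0 (t - (1 - ε))) a ht (by fun_prop)
        (by simp; linarith)
      rw [h0, norm_zero] at h1
      have := norm_le_zero_iff.mp h1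
      have := le_max_right 0 (t - (1 - ε))
      linarith
    have := norm_cfcₙ_le (𝕜 := ℝ) (f := id) (a := a) (c := 1 - ε) fun t ht => by
      rw [Real.norm_eq_abs, abs_le]
      exact ⟨by have := hspec0 t ht; simp only [id]; linarith, hd t ht⟩
    rw [cfcₙ_id ℝ a, ha1] at this
    linarith
  · refine norm_cfcₙ_le fun t ht => ?_
    have h0 := hspec0 t ht
    have h1 := hspec1 t ht
    rw [Real.norm_eq_abs, abs_le]
    refine ⟨le_trans ?_ (le_max_left _ _), max_le ?_ ?_⟩ <;> nlinarith
  · have hd : ContinuousOn (fun t : ℝ => max 0 (t - (1 - ε))) (quasispectrum ℝ a) := by fun_prop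
    have hk : ContinuousOn (fun t : ℝ => max (-(2 * ε * t)) (t - 1)) (quasispectrum ℝ a) := by
      fun_prop
    have hd0 : max 0 ((0 : ℝ) - (1 - ε)) = 0 := by simp; linarith
    have hk0 : max (-(2 * ε * (0 : ℝ))) (0 - 1) = 0 := by simp
    -- Both sides are functions of `a`; the identity holds where `t ≤ 1 - ε`, since `d` vanishes
    -- there, and where `t ≥ 1 - ε`, since there `k` is `t - 1`.
    nth_rw 1 [← cfcₙ_id' ℝ a hsa]
    rw [← cfcₙ_mul (fun t : ℝ => t) _ a (by fun_prop) rfl hd hd0,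
      ← cfcₙ_mul _ _ a hk hk0 hd hd0,
      ← cfcₙ_add _ _ a hd hd0 (by fun_prop) (by simp)]
    refine cfcₙ_congr fun t ht => ?_
    have h0 := hspec0 t ht
    have h1 := hspec1 t ht
    rcases le_total t (1 - ε) with h | h
    · simp [max_eq_left (show t - (1 - ε) ≤ 0 by linarith)]
    · simp only [max_eq_right (show 0 ≤ t - (1 - ε) by linarith),
        max_eq_right (show -(2 * ε * t) ≤ t - 1 by nlinarith)]
      ring

/-- A subspace of `S*` that is invariant under both actions of `S` and separates the points of `S`
is norming. A functional in the subspace can be localised, by a multiplication on the right, near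
the part of the spectrum of `s* s` where it is almost constant; a multiplication on the left then
makes its value at that constant almost equal to its norm. -/
theorem norm_le_of_invariant_of_separating (A : Submodule ℂ (StrongDual ℂ S))
    (hl : ∀ f ∈ A, ∀ s : S, f ∘L (ContinuousLinearMap.mul ℂ S).flip s ∈ A)
    (hr : ∀ f ∈ A, ∀ s : S, f ∘L ContinuousLinearMap.mul ℂ S s ∈ A)
    (hsep : ∀ s, (∀ f ∈ A, f s = 0) → s = 0) (s : S) (C : ℝ)
    (hC : ∀ f ∈ A, ‖f‖ ≤ 1 → ‖f s‖ ≤ C) : ‖s‖ ≤ C := by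
  by_contra! hlt
  -- Reduction to an element `r` of norm one, at which `A` has norm at most `c < 1`.
  have hC0 : 0 ≤ C := by simpa using hC 0 A.zero_mem (by simp)
  have hs0 : 0 < ‖s‖ := hC0.trans_lt hlt
  have hCA : ∀ f ∈ A, ‖f s‖ ≤ C * ‖f‖ := by
    intro f hf
    rcases eq_or_ne f 0 with rfl | hf0
    · simp
    have hf0 : 0 < ‖f‖ := norm_pos_iff.mpr hf0
    have := hC ((‖f‖⁻¹ : ℂ) • f) (A.smul_mem _ hf) (by simp [norm_smul, hf0.ne'])
    rw [smul_apply, norm_smul, norm_inv, Complex.norm_real, norm_norm,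
      inv_mul_le_iff₀ hf0] at this
    linarith
  obtain ⟨c, hc⟩ : ∃ c, c = C / ‖s‖ := ⟨_, rfl⟩
  have hc0 : 0 ≤ c := by rw [hc]; positivity
  have hc1 : c < 1 := by rw [hc, div_lt_one hs0]; exact hlt
  obtain ⟨r, hr'⟩ : ∃ r : S, r = (‖s‖⁻¹ : ℂ) • s := ⟨_, rfl⟩
  have hr1 : ‖r‖ = 1 := by simp [hr', norm_smul, hs0.ne']
  have hcA : ∀ f ∈ A, ‖f r‖ ≤ c * ‖f‖ := by
    intro f hf
    rw [hr', map_smul, norm_smul, norm_inv, Complex.norm_real, norm_norm, hc,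
      inv_mul_le_iff₀ hs0]
    calc _ ≤ _ := hCA f hf
      _ = _ := by field_simp
  obtain ⟨d, k, hd, hk, hdk⟩ := exists_mul_eq_add_mul r hr1 (ε := (1 - c) / 4) (by linarith)
    (by linarith)
  obtain ⟨f, hf, hfd⟩ : ∃ f ∈ A, f (star d * d) ≠ 0 := by
    by_contra! h
    exact hd (CStarRing.star_mul_self_eq_zero_iff _ |>.mp (hsep _ h))
  -- The functional `g` is concentrated where `star r * r` is almost the identity, and `x` almost
  -- attains its norm, so `g (x * (star r * r))` is close to `‖g‖`; this contradicts `hcA`.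
  obtain ⟨g, hg⟩ : ∃ g, g = f ∘L (ContinuousLinearMap.mul ℂ S).flip d := ⟨_, rfl⟩
  have hgA : g ∈ A := hg ▸ hl f hf d
  have hgx : ∀ x, g x = f (x * d) := fun x => by rw [hg]; rfl
  have hg0 : 0 < ‖g‖ := norm_pos_iff.mpr fun h => hfd (by rw [← hgx, h]; rfl)
  obtain ⟨x, hx1, hx⟩ := g.exists_lt_apply_of_lt_opNorm
    (show (1 - (1 - c) / 4) * ‖g‖ < ‖g‖ by nlinarith)
  have h1 : ‖g (x * (star r * r))‖ ≤ c * ‖g‖ := by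
    refine (hcA _ (hr g hgA (x * star r)) |>.trans ?_ |> (by simpa [mul_assoc] using ·))
    gcongr
    refine ContinuousLinearMap.opNorm_le_bound _ hg0.le fun y => (g.le_opNorm _).trans ?_
    gcongr
    change ‖x * star r * y‖ ≤ _
    refine (norm_mul_le _ _).trans (mul_le_of_le_one_left (norm_nonneg _) ?_)
    refine (norm_mul_le _ _).trans ?_
    rw [norm_star, hr1, mul_one]
    exact hx1.le
  have h2 : g (x * (star r * r)) = g x + g (x * k) := by
    rw [hgx, hgx, hgx, mul_assoc, hdk, mul_add, map_add, mul_assoc x k d]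
  have h3 : ‖g (x * k)‖ ≤ 2 * ((1 - c) / 4) * ‖g‖ := by
    refine (g.le_opNorm _).trans ?_
    rw [mul_comm]
    gcongr
    refine (norm_mul_le _ _).trans ?_
    nlinarith [norm_nonneg k, norm_nonneg x]
  have h4 : ‖g x‖ ≤ ‖g (x * (star r * r))‖ + ‖g (x * k)‖ := by
    rw [show g x = g (x * (star r * r)) - g (x * k) by rw [h2]; ring]
    exact norm_sub_le _ _
  nlinarith

end Norming

/-! ### Weak-* approximation in dual spaces -/

section WeakStar

variable {E : Type*} [NormedAddCommGroup E] [NormedSpace ℂ E]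

/-- If the unit ball of a subspace `A` of the dual of `E` is norming, then every functional `u` is
a weak-* limit of functionals in `A` of norm at most `‖u‖`. -/
theorem exists_mem_norm_le_of_norming (A : Submodule ℂ (StrongDual ℂ E))
    (hA : ∀ s C, (∀ f ∈ A, ‖f‖ ≤ 1 → ‖f s‖ ≤ C) → ‖s‖ ≤ C) (u : StrongDual ℂ E) (F : Finset E)
    {ε : ℝ} (hε : 0 < ε) : ∃ f ∈ A, ‖f‖ ≤ ‖u‖ ∧ ∀ s ∈ F, ‖f s - u s‖ < ε := by
  classical
  let T : StrongDual ℂ E →ₗ[ℂ] (F → ℂ) :=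
    { toFun := fun f s => f s
      map_add' := fun _ _ => rfl
      map_smul' := fun _ _ => rfl }
  let B : Set (F → ℂ) := T '' {f | f ∈ A ∧ ‖f‖ ≤ ‖u‖}
  by_cases hu : T u ∈ closure B
  · obtain ⟨_, ⟨f, ⟨hfA, hfu⟩, rfl⟩, hf⟩ := Metric.mem_closure_iff.mp hu ε hε
    refine ⟨f, hfA, hfu, fun s hs => ?_⟩
    rw [dist_comm, dist_pi_lt_iff hε] at hf
    exact (dist_eq_norm _ _).symm.trans_lt (hf ⟨s, hs⟩)
  exfalso
  have hB : Convex ℝ B := by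
    have : Convex ℝ {f : StrongDual ℂ E | f ∈ A ∧ ‖f‖ ≤ ‖u‖} := by
      rintro f ⟨hf, hfu⟩ g ⟨hg, hgu⟩ a b ha hb hab
      refine ⟨A.add_mem (A.smul_mem (a : ℂ) hf) (A.smul_mem (b : ℂ) hg), ?_⟩
      have := convex_closedBall (0 : StrongDual ℂ E) ‖u‖ (mem_closedBall_zero_iff.mpr hfu)
        (mem_closedBall_zero_iff.mpr hgu) ha hb hab
      exact mem_closedBall_zero_iff.mp this
    exact this.linear_image (T.restrictScalars ℝ)
  obtain ⟨φ, r, hφ, hr⟩ := RCLike.geometric_hahn_banach_closed_point (𝕜 := ℂ) hB.closure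
    isClosed_closure hu
  -- A functional on `F → ℂ`, composed with restriction to `F`, is the evaluation at a linear
  -- combination of the points of `F`.
  obtain ⟨s, hs⟩ : ∃ s : E, ∀ f, φ (T f) = f s := by
    refine ⟨∑ i : F, (φ fun j => if i = j then 1 else 0) • (i : E), fun f => ?_⟩
    have := LinearMap.pi_apply_eq_sum_univ φ.toLinearMap (T f)
    simp only [map_sum, map_smul, smul_eq_mul]
    refine this.trans (Finset.sum_congr rfl fun i _ => ?_)
    exact mul_comm _ _
  have hAs : ∀ f ∈ A, ‖f‖ ≤ 1 → ‖u‖ * ‖f s‖ ≤ r := by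
    intro f hf hf1
    obtain ⟨c, hc, hc'⟩ := Complex.exists_norm_eq_mul_self (f s)
    have := hφ (T ((‖u‖ * c : ℂ) • f)) (subset_closure ⟨_, ⟨A.smul_mem _ hf, by
      rw [norm_smul, norm_mul, hc, Complex.norm_real, norm_norm, mul_one]
      exact mul_le_of_le_one_right (norm_nonneg _) hf1⟩, rfl⟩)
    rw [hs, smul_apply, smul_eq_mul, mul_assoc, ← hc'] at this
    norm_cast at this
    simpa using this.le
  have hus : ‖u‖ * ‖s‖ ≤ r := by
    rcases (norm_nonneg u).eq_or_lt with h0 | h0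
    · have := hAs 0 A.zero_mem (by simp)
      rw [← h0] at this ⊢
      simpa using this
    · rw [mul_comm, ← le_div_iff₀ h0]
      refine hA s _ fun f hf hf1 => ?_
      rw [le_div_iff₀ h0, mul_comm]
      exact hAs f hf hf1
  rw [hs] at hr
  have := (Complex.re_le_norm (u s)).trans (u.le_opNorm s)
  exact absurd (hr.trans_le this) hus.not_gt

/-- A function on the dual of a Banach space that is a limit, uniformly on bounded sets, of
evaluations at points is itself the evaluation at a point. -/
theorem exists_eq_apply_of_approx [CompleteSpace E] (Φ : StrongDual ℂ E → ℂ)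
    (h : ∀ ε > 0, ∃ r : E, ∀ f, ‖Φ f - f r‖ ≤ ε * ‖f‖) : ∃ r : E, ∀ f, Φ f = f r := by
  have hn : ∀ n : ℕ, 0 < 1 / ((n : ℝ) + 1) := fun n => by positivity
  choose r hr using fun n : ℕ => h (1 / ((n : ℝ) + 1)) (hn n)
  have hlim := tendsto_one_div_add_atTop_nhds_zero_nat (𝕜 := ℝ)
  have hcau : CauchySeq r := by
    refine cauchySeq_of_le_tendsto_0 (fun n => 2 * (1 / ((n : ℝ) + 1))) (fun n m N hn hm => ?_)
      (by simpa using hlim.const_mul 2)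
    have mono : ∀ k, N ≤ k → 1 / ((k : ℝ) + 1) ≤ 1 / ((N : ℝ) + 1) := fun k hk =>
      one_div_le_one_div_of_le (by positivity) (by exact_mod_cast Nat.succ_le_succ hk)
    rw [dist_eq_norm]
    refine NormedSpace.norm_le_dual_bound ℂ _ (by positivity) fun f => ?_
    rw [map_sub, show f (r n) - f (r m) = (Φ f - f (r m)) - (Φ f - f (r n)) by ring]
    refine (norm_sub_le _ _).trans ?_
    have h1 := hr n f
    have h2 := hr m f
    nlinarith [norm_nonneg f, mono n hn, mono m hm]
  obtain ⟨l, hl⟩ := cauchySeq_tendsto_of_complete hcau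
  refine ⟨l, fun f => ?_⟩
  have h1 : Tendsto (fun n => Φ f - f (r n)) atTop (𝓝 (Φ f - f l)) :=
    tendsto_const_nhds.sub ((f.continuous.tendsto _).comp hl)
  have h2 : Tendsto (fun n => Φ f - f (r n)) atTop (𝓝 0) :=
    squeeze_zero_norm (fun n => hr n f) (by simpa using hlim.mul_const ‖f‖)
  exact sub_eq_zero.mp (tendsto_nhds_unique h1 h2)

end WeakStar

/-! ### Product functionals on the multiplier algebra -/

section Functionals

variable {C : Type*} [NonUnitalCStarAlgebra C]

theorem strictExt_sub (F G : StrongDual ℂ C) (m : 𝓜(ℂ, C)) :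
    strictExt (F - G) m = strictExt F m - strictExt G m :=
  tendsto_nhds_unique (tendsto_strictExt (F - G) m)
    (by simpa using (tendsto_strictExt F m).sub (tendsto_strictExt G m))

theorem norm_strictExt_apply_le (F : StrongDual ℂ C) (m : 𝓜(ℂ, C)) :
    ‖strictExt F m‖ ≤ ‖F‖ * ‖m‖ :=
  (strictExt F).le_of_opNorm_le (LinearMap.mkContinuous_norm_le _ (norm_nonneg F) _) m

variable {S : Type*} [NonUnitalCStarAlgebra S]
  {H : Type*} [NormedAddCommGroup H] [InnerProductSpace ℂ H] [CompleteSpace H]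

theorem MinTensor.dual_ext {π : FaithfulRep S H} {F G : StrongDual ℂ (MinTensor π)}
    (h : ∀ a b, F (MinTensor.ofAlg π (a ⊗ₜ b)) = G (MinTensor.ofAlg π (a ⊗ₜ b))) : F = G := by
  ext x
  induction x using MinTensor.induction_on with
  | hc => exact isClosed_eq (by fun_prop) (by fun_prop)
  | hadd x y hx hy => rw [map_add, map_add, hx, hy]
  | h0 => simp
  | h a b => exact h a b

theorem tensorFunctional_sub_left (π : FaithfulRep S H) (f f' g : StrongDual ℂ S) :
    tensorFunctional π (f - f') g = tensorFunctional π f g - tensorFunctional π f' g :=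
  MinTensor.dual_ext fun a b => by
    simp [tensorFunctional_ofAlg, sub_mul]

theorem tensorFunctional_sub_right (π : FaithfulRep S H) (f g g' : StrongDual ℂ S) :
    tensorFunctional π f (g - g') = tensorFunctional π f g - tensorFunctional π f g' :=
  MinTensor.dual_ext fun a b => by
    simp [tensorFunctional_ofAlg, mul_sub]

theorem norm_tensorFunctional_le (π : FaithfulRep S H) (f g : StrongDual ℂ S) :
    ‖tensorFunctional π f g‖ ≤ ‖f‖ * ‖g‖ := by
  refine ContinuousLinearMap.opNorm_le_bound _ (by positivity) fun x => ?_
  refine (MinTensor.denseRange_ofAlg π).induction_on x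
    (isClosed_le (by fun_prop) (by fun_prop)) fun y => ?_
  rw [tensorFunctional_ofAlg]
  exact norm_algFunctional_le π f g y

theorem incl_rightLeg_fst (π : FaithfulRep S H) (t : S) (c : MinTensor π) :
    MinTensor.incl π ((rightLeg π t).fst c) = opTensor 1 (π.toHom t) * MinTensor.incl π c :=
  incl_ofIdealizer_fst π _ _ _ c

theorem incl_rightLeg_snd (π : FaithfulRep S H) (t : S) (c : MinTensor π) :
    MinTensor.incl π ((rightLeg π t).snd c) = MinTensor.incl π c * opTensor 1 (π.toHom t) :=
  incl_ofIdealizer_snd π _ _ _ c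

theorem incl_leftLeg_fst (π : FaithfulRep S H) (t : S) (c : MinTensor π) :
    MinTensor.incl π ((leftLeg π t).fst c) = opTensor (π.toHom t) 1 * MinTensor.incl π c :=
  incl_ofIdealizer_fst π _ _ _ c

theorem incl_leftLeg_snd (π : FaithfulRep S H) (t : S) (c : MinTensor π) :
    MinTensor.incl π ((leftLeg π t).snd c) = MinTensor.incl π c * opTensor (π.toHom t) 1 :=
  incl_ofIdealizer_snd π _ _ _ c

theorem rightLeg_fst_ofAlg (π : FaithfulRep S H) (t a b : S) :
    (rightLeg π t).fst (MinTensor.ofAlg π (a ⊗ₜ b)) = MinTensor.ofAlg π (a ⊗ₜ (t * b)) :=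
  MinTensor.incl_injective π (by simp [incl_rightLeg_fst, opTensor_mul])

theorem leftLeg_fst_ofAlg (π : FaithfulRep S H) (t a b : S) :
    (leftLeg π t).fst (MinTensor.ofAlg π (a ⊗ₜ b)) = MinTensor.ofAlg π ((t * a) ⊗ₜ b) :=
  MinTensor.incl_injective π (by simp [incl_leftLeg_fst, opTensor_mul])

theorem eq_of_fst_apply_eq {m n : 𝓜(ℂ, C)} (h : ∀ c, m.fst c = n.fst c) : m = n := by
  have hf : m.fst = n.fst := ContinuousLinearMap.ext h
  refine DoubleCentralizer.ext ℂ C m n (Prod.ext hf (ContinuousLinearMap.ext fun c => ?_))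
  have hz : ∀ z, (m.snd c - n.snd c) * z = 0 := fun z => by
    rw [sub_mul, m.central, n.central, h, sub_self]
  exact sub_eq_zero.mp (CStarRing.mul_star_self_eq_zero_iff _ |>.mp (hz _))

theorem star_rightLeg (π : FaithfulRep S H) (t : S) :
    star (rightLeg π t) = rightLeg π (star t) :=
  eq_of_fst_apply_eq fun c => MinTensor.incl_injective π (by
    rw [DoubleCentralizer.star_fst, map_star, incl_rightLeg_snd, incl_rightLeg_fst,
      star_mul, ← map_star, star_star, opTensor_star, ← map_star, star_one])

theorem star_leftLeg (π : FaithfulRep S H) (t : S) :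
    star (leftLeg π t) = leftLeg π (star t) :=
  eq_of_fst_apply_eq fun c => MinTensor.incl_injective π (by
    rw [DoubleCentralizer.star_fst, map_star, incl_leftLeg_snd, incl_leftLeg_fst,
      star_mul, ← map_star, star_star, opTensor_star, ← map_star, star_one])

/-- If `L` is multiplication by a multiplier `l` on the left and `l * m` lies in the C⋆-algebra,
then the strict extension of `F ∘ L` at `m` is the value of `F` at `l * m`. -/
theorem strictExt_eq_of_mul_eq_coe {F G : StrongDual ℂ C} {l m : 𝓜(ℂ, C)} {x : C}
    (hF : ∀ c, G c = F (l.fst c)) (hx : DoubleCentralizer.coeHom (𝕜 := ℂ) x = l * m) :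
    strictExt G m = F x := by
  refine tendsto_nhds_unique (tendsto_strictExt G m) ?_
  have h : ∀ e, G (m.fst e) = F (x * e) := by
    intro e
    rw [hF, ← mul_apply_eq_comp, ← DoubleCentralizer.mul_fst, ← hx]
    rfl
  simp_rw [h]
  exact (F.continuous.tendsto _).comp (tendsto_mul_approxUnit x)

/-- The slice map `id ⊗ g` maps `S ⊗ S` to `S`. -/
theorem exists_tensorFunctional_eq_left (π : FaithfulRep S H) (g : StrongDual ℂ S)
    (x : MinTensor π) : ∃ r, ∀ f, tensorFunctional π f g x = f r := by
  refine exists_eq_apply_of_approx _ fun ε hε => ?_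
  obtain ⟨y, hy⟩ := (MinTensor.denseRange_ofAlg π).exists_dist_lt x
    (show 0 < ε / (‖g‖ + 1) by positivity)
  refine ⟨sliceRight g y, fun f => ?_⟩
  change ‖_ - algFunctional f g y‖ ≤ _
  rw [← tensorFunctional_ofAlg π, ← map_sub]
  refine ((tensorFunctional π f g).le_of_opNorm_le (norm_tensorFunctional_le π f g) _).trans ?_
  rw [dist_eq_norm, lt_div_iff₀ (by positivity)] at hy
  nlinarith [norm_nonneg f, norm_nonneg g, norm_nonneg (x - MinTensor.ofAlg π y),
    mul_le_mul_of_nonneg_left hy.le (norm_nonneg f),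
    mul_nonneg (norm_nonneg f) (norm_nonneg (x - MinTensor.ofAlg π y))]

/-- The slice map `f ⊗ id` maps `S ⊗ S` to `S`. -/
theorem exists_tensorFunctional_eq_right (π : FaithfulRep S H) (f : StrongDual ℂ S)
    (x : MinTensor π) : ∃ r, ∀ g, tensorFunctional π f g x = g r := by
  refine exists_eq_apply_of_approx _ fun ε hε => ?_
  obtain ⟨y, hy⟩ := (MinTensor.denseRange_ofAlg π).exists_dist_lt x
    (show 0 < ε / (‖f‖ + 1) by positivity)
  refine ⟨sliceLeft f y, fun g => ?_⟩
  rw [← algFunctional_eq, ← tensorFunctional_ofAlg π, ← map_sub]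
  refine ((tensorFunctional π f g).le_of_opNorm_le (norm_tensorFunctional_le π f g) _).trans ?_
  rw [dist_eq_norm, lt_div_iff₀ (by positivity)] at hy
  nlinarith [norm_nonneg f, norm_nonneg g, norm_nonneg (x - MinTensor.ofAlg π y),
    mul_le_mul_of_nonneg_left hy.le (norm_nonneg g),
    mul_nonneg (norm_nonneg g) (norm_nonneg (x - MinTensor.ofAlg π y))]

theorem tensorFunctional_vec {K₁ K₂ : Type*} [NormedAddCommGroup K₁] [InnerProductSpace ℂ K₁]
    [CompleteSpace K₁] [NormedAddCommGroup K₂] [InnerProductSpace ℂ K₂] [CompleteSpace K₂]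
    (π : FaithfulRep S H) (φ : S →⋆ₙₐ[ℂ] (K₁ →L[ℂ] K₁)) (ψ : S →⋆ₙₐ[ℂ] (K₂ →L[ℂ] K₂))
    (η ξ : K₁) (η' ξ' : K₂) :
    tensorFunctional π (vecFunctional φ η ξ) (vecFunctional ψ η' ξ') =
      vecFunctional (tensorRep π φ ψ) (vec η η') (vec ξ ξ') :=
  MinTensor.dual_ext fun a b => by
    rw [tensorFunctional_ofAlg, algFunctional_vec, vecFunctional_apply, tensorRep_ofAlg]

theorem strictExt_vecFunctional {K : Type*} [NormedAddCommGroup K] [InnerProductSpace ℂ K]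
    [CompleteSpace K] (θ : C →⋆ₙₐ[ℂ] (K →L[ℂ] K)) (η ξ : K) (m : 𝓜(ℂ, C)) :
    strictExt (vecFunctional θ η ξ) m = ⟪η, repExt θ m ξ⟫_ℂ :=
  tendsto_nhds_unique (tendsto_strictExt _ m)
    (tendsto_const_nhds.inner (tendsto_repExtApply θ m ξ))

theorem tensorRep_self (π : FaithfulRep S H) :
    tensorRep π π.toHom π.toHom = MinTensor.incl π := by
  ext1 x
  induction x using MinTensor.induction_on with
  | hc =>
    refine isClosed_eq ?_ (continuous_incl π)
    exact (tensorRepAux π π.toHom π.toHom).continuous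
  | hadd x y hx hy => rw [map_add, map_add, hx, hy]
  | h0 => simp
  | h a b => rw [tensorRep_ofAlg, MinTensor.incl_ofAlg]

theorem FaithfulRep.eq_of_forall_vecFunctional_eq (π : FaithfulRep S H) {r r' : S}
    (h : ∀ η ξ, vecFunctional π.toHom η ξ r = vecFunctional π.toHom η ξ r') : r = r' :=
  π.injective (ContinuousLinearMap.ext fun ξ => ext_inner_left ℂ fun η => h η ξ)

end Functionals

/-! ### The product on the dual space -/

namespace HopfCStarAlgebra

variable {S : Type u} [NonUnitalCStarAlgebra S]
  {H : Type v} [NormedAddCommGroup H] [InnerProductSpace ℂ H] [CompleteSpace H]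
  {π : FaithfulRep S H} (𝒮 : HopfCStarAlgebra π)

theorem conv_sub_left_apply (f f' g : StrongDual ℂ S) (s : S) :
    𝒮.conv (f - f') g s = 𝒮.conv f g s - 𝒮.conv f' g s := by
  simp only [conv_apply, tensorFunctional_sub_left, strictExt_sub]

theorem conv_sub_right_apply (f g g' : StrongDual ℂ S) (s : S) :
    𝒮.conv f (g - g') s = 𝒮.conv f g s - 𝒮.conv f g' s := by
  simp only [conv_apply, tensorFunctional_sub_right, strictExt_sub]

theorem norm_conv_apply_le (f g : StrongDual ℂ S) (s : S) :
    ‖𝒮.conv f g s‖ ≤ ‖f‖ * ‖g‖ * ‖s‖ := by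
  rw [conv_apply]
  refine (norm_strictExt_apply_le _ _).trans ?_
  gcongr
  · exact norm_tensorFunctional_le π f g
  · exact NonUnitalStarAlgHom.norm_apply_le 𝒮.δ s

theorem exists_coe_eq_rightLeg_mul (s t : S) : ∃ x : MinTensor π,
    DoubleCentralizer.coeHom (𝕜 := ℂ) x = rightLeg π t * 𝒮.δ s := by
  obtain ⟨x, hx⟩ := 𝒮.mul_rightLeg_mem (star s) (star t)
  exact ⟨star x, by rw [map_star, hx, star_mul, star_rightLeg, star_star, map_star, star_star]⟩

theorem exists_coe_eq_leftLeg_mul (s t : S) : ∃ x : MinTensor π,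
    DoubleCentralizer.coeHom (𝕜 := ℂ) x = leftLeg π t * 𝒮.δ s := by
  obtain ⟨x, hx⟩ := 𝒮.mul_leftLeg_mem (star s) (star t)
  exact ⟨star x, by rw [map_star, hx, star_mul, star_leftLeg, star_star, map_star, star_star]⟩

theorem conv_comp_mul_right (f g : StrongDual ℂ S) {s t : S} {x : MinTensor π}
    (hx : DoubleCentralizer.coeHom (𝕜 := ℂ) x = rightLeg π t * 𝒮.δ s) :
    𝒮.conv f (g ∘L ContinuousLinearMap.mul ℂ S t) s = tensorFunctional π f g x := by
  refine strictExt_eq_of_mul_eq_coe (fun c => ?_) hx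
  refine congr($(MinTensor.dual_ext (G := tensorFunctional π f g ∘L (rightLeg π t).fst)
    fun a b => ?_) c)
  simp [tensorFunctional_ofAlg, rightLeg_fst_ofAlg]

theorem conv_comp_mul_left (f g : StrongDual ℂ S) {s t : S} {x : MinTensor π}
    (hx : DoubleCentralizer.coeHom (𝕜 := ℂ) x = leftLeg π t * 𝒮.δ s) :
    𝒮.conv (f ∘L ContinuousLinearMap.mul ℂ S t) g s = tensorFunctional π f g x := by
  refine strictExt_eq_of_mul_eq_coe (fun c => ?_) hx
  refine congr($(MinTensor.dual_ext (G := tensorFunctional π f g ∘L (leftLeg π t).fst)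
    fun a b => ?_) c)
  simp [tensorFunctional_ofAlg, leftLeg_fst_ofAlg]

/-- The slice `(id ⊗ g) δ(s)` lies in `S`; in other words, `f ↦ f g` is weak-* continuous. Indeed
`g` is a norm limit of functionals `g(t ·)`, and `(1 ⊗ t) δ(s)` lies in `S ⊗ S`. -/
theorem exists_conv_apply_eq_left (g : StrongDual ℂ S) (s : S) :
    ∃ r, ∀ f, 𝒮.conv f g s = f r := by
  refine exists_eq_apply_of_approx _ fun ε hε => ?_
  obtain ⟨t, ht⟩ := exists_norm_sub_mul_le g (ε := ε / (‖s‖ + 1)) (by positivity)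
  obtain ⟨x, hx⟩ := 𝒮.exists_coe_eq_rightLeg_mul s t
  obtain ⟨r, hr⟩ := exists_tensorFunctional_eq_left π g x
  refine ⟨r, fun f => ?_⟩
  rw [← hr, ← 𝒮.conv_comp_mul_right f g hx, ← conv_sub_right_apply]
  refine (𝒮.norm_conv_apply_le _ _ _).trans ?_
  have h : ‖g - g ∘L ContinuousLinearMap.mul ℂ S t‖ ≤ ε / (‖s‖ + 1) :=
    ContinuousLinearMap.opNorm_le_bound _ (by positivity) fun c => by simpa using ht c
  rw [le_div_iff₀ (by positivity)] at h
  nlinarith [norm_nonneg f, norm_nonneg (g - g ∘L ContinuousLinearMap.mul ℂ S t),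
    mul_le_mul_of_nonneg_left h (norm_nonneg f),
    mul_nonneg (norm_nonneg f) (norm_nonneg (g - g ∘L ContinuousLinearMap.mul ℂ S t))]

/-- The slice `(f ⊗ id) δ(s)` lies in `S`; in other words, `g ↦ f g` is weak-* continuous. -/
theorem exists_conv_apply_eq_right (f : StrongDual ℂ S) (s : S) :
    ∃ r, ∀ g, 𝒮.conv f g s = g r := by
  refine exists_eq_apply_of_approx _ fun ε hε => ?_
  obtain ⟨t, ht⟩ := exists_norm_sub_mul_le f (ε := ε / (‖s‖ + 1)) (by positivity)
  obtain ⟨x, hx⟩ := 𝒮.exists_coe_eq_leftLeg_mul s t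
  obtain ⟨r, hr⟩ := exists_tensorFunctional_eq_right π f x
  refine ⟨r, fun g => ?_⟩
  rw [← hr, ← 𝒮.conv_comp_mul_left f g hx, ← conv_sub_left_apply]
  refine (𝒮.norm_conv_apply_le _ _ _).trans ?_
  have h : ‖f - f ∘L ContinuousLinearMap.mul ℂ S t‖ ≤ ε / (‖s‖ + 1) :=
    ContinuousLinearMap.opNorm_le_bound _ (by positivity) fun c => by simpa using ht c
  rw [le_div_iff₀ (by positivity)] at h
  nlinarith [norm_nonneg g, norm_nonneg (f - f ∘L ContinuousLinearMap.mul ℂ S t),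
    mul_le_mul_of_nonneg_left h (norm_nonneg g),
    mul_nonneg (norm_nonneg g) (norm_nonneg (f - f ∘L ContinuousLinearMap.mul ℂ S t))]

theorem conv_vecFunctional (η₁ η₂ ξ₁ ξ₂ : H) :
    𝒮.conv (vecFunctional π.toHom η₁ ξ₁) (vecFunctional π.toHom η₂ ξ₂) =
      vecFunctional (coactionRep 𝒮.δ) (vec η₁ η₂) (vec ξ₁ ξ₂) := by
  ext s
  rw [conv_apply, tensorFunctional_vec, strictExt_vecFunctional, tensorRep_self]
  rfl

/-- On vector functionals, associativity of the product is coassociativity of `δ`. -/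
theorem conv_assoc_vecFunctional (η₁ η₂ η₃ ξ₁ ξ₂ ξ₃ : H) (s : S) :
    𝒮.conv (𝒮.conv (vecFunctional π.toHom η₁ ξ₁) (vecFunctional π.toHom η₂ ξ₂))
        (vecFunctional π.toHom η₃ ξ₃) s =
      𝒮.conv (vecFunctional π.toHom η₁ ξ₁)
        (𝒮.conv (vecFunctional π.toHom η₂ ξ₂) (vecFunctional π.toHom η₃ ξ₃)) s := by
  simp only [conv_vecFunctional]
  rw [conv_apply, conv_apply, tensorFunctional_vec, tensorFunctional_vec, strictExt_vecFunctional,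
    strictExt_vecFunctional]
  exact 𝒮.coassoc s ξ₁ ξ₂ ξ₃ η₁ η₂ η₃

/-- The product of `S*` is associative. Both triple products are weak-* continuous in each of the
three variables, and the vector functionals of `π` separate the points of `S`. -/
theorem conv_assoc_apply (f g h : StrongDual ℂ S) (s : S) :
    𝒮.conv (𝒮.conv f g) h s = 𝒮.conv f (𝒮.conv g h) s := by
  have key₁ : ∀ (f : StrongDual ℂ S) (η₂ η₃ ξ₂ ξ₃ : H),
      𝒮.conv (𝒮.conv f (vecFunctional π.toHom η₂ ξ₂)) (vecFunctional π.toHom η₃ ξ₃) s =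
        𝒮.conv f (𝒮.conv (vecFunctional π.toHom η₂ ξ₂) (vecFunctional π.toHom η₃ ξ₃)) s := by
    intro f η₂ η₃ ξ₂ ξ₃
    obtain ⟨r, hr⟩ := 𝒮.exists_conv_apply_eq_left (vecFunctional π.toHom η₃ ξ₃) s
    obtain ⟨a, ha⟩ := 𝒮.exists_conv_apply_eq_left (vecFunctional π.toHom η₂ ξ₂) r
    obtain ⟨b, hb⟩ := 𝒮.exists_conv_apply_eq_left
      (𝒮.conv (vecFunctional π.toHom η₂ ξ₂) (vecFunctional π.toHom η₃ ξ₃)) s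
    have hab : a = b := π.eq_of_forall_vecFunctional_eq fun η ξ => by
      rw [← ha, ← hr, ← hb, conv_assoc_vecFunctional]
    rw [hr, ha, hb, hab]
  have key₂ : ∀ (f g : StrongDual ℂ S) (η₃ ξ₃ : H),
      𝒮.conv (𝒮.conv f g) (vecFunctional π.toHom η₃ ξ₃) s =
        𝒮.conv f (𝒮.conv g (vecFunctional π.toHom η₃ ξ₃)) s := by
    intro f g η₃ ξ₃
    obtain ⟨r, hr⟩ := 𝒮.exists_conv_apply_eq_left (vecFunctional π.toHom η₃ ξ₃) s
    obtain ⟨a, ha⟩ := 𝒮.exists_conv_apply_eq_right f r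
    obtain ⟨r', hr'⟩ := 𝒮.exists_conv_apply_eq_right f s
    obtain ⟨b, hb⟩ := 𝒮.exists_conv_apply_eq_left (vecFunctional π.toHom η₃ ξ₃) r'
    have hab : a = b := π.eq_of_forall_vecFunctional_eq fun η ξ => by
      rw [← ha, ← hr, ← hb, ← hr', key₁]
    rw [hr, ha, hr', hb, hab]
  obtain ⟨a, ha⟩ := 𝒮.exists_conv_apply_eq_right (𝒮.conv f g) s
  obtain ⟨r, hr⟩ := 𝒮.exists_conv_apply_eq_right f s
  obtain ⟨b, hb⟩ := 𝒮.exists_conv_apply_eq_right g r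
  have hab : a = b := π.eq_of_forall_vecFunctional_eq fun η ξ => by
    rw [← ha, ← hb, ← hr, key₂]
  rw [ha, hr, hb, hab]

/-- A functional annihilating a non-zero invariant subspace from the left is zero: by invariance
`h ⊗ g` vanishes on all `(1 ⊗ t) δ(s)`, whose linear span is dense. -/
theorem eq_zero_of_conv_eq_zero (h𝒮 : 𝒮.IsSaturated) {A : Submodule ℂ (StrongDual ℂ S)}
    (hA : 𝒮.IsLeftHopfIdeal A) {h : StrongDual ℂ S} (hh : ∀ g ∈ A, ∀ s, 𝒮.conv h g s = 0) :
    h = 0 := by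
  obtain ⟨g, hg, hg0⟩ := A.ne_bot_iff.mp hA.ne_bot
  obtain ⟨b, hb⟩ : ∃ b, g b ≠ 0 := by
    by_contra! hb
    exact hg0 (ContinuousLinearMap.ext hb)
  have hzero : ∀ x : MinTensor π, tensorFunctional π h g (star x) = 0 := by
    intro x
    refine h𝒮.1.induction (P := fun x => tensorFunctional π h g (star x) = 0) (fun x hx => ?_)
      (isClosed_eq (by fun_prop) (by fun_prop)) x
    induction hx using Submodule.span_induction with
    | mem x hx =>
      obtain ⟨s, t, hx⟩ := hx
      rw [← 𝒮.conv_comp_mul_right h g (s := star s) (t := star t) (by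
        rw [map_star, hx, star_mul, star_rightLeg, map_star])]
      exact hh _ (hA.invariant_right g hg _) _
    | zero => simp
    | add x y _ _ hx hy => rw [star_add, map_add, hx, hy, add_zero]
    | smul c x _ hx => rw [star_smul, map_smul, hx, smul_zero]
  ext a
  have := hzero (star (MinTensor.ofAlg π (a ⊗ₜ b)))
  rw [star_star, tensorFunctional_ofAlg, algFunctional_tmul] at this
  exact (mul_eq_zero.mp this).resolve_right hb

/-! ### Units and bounded approximate units -/

/-- A weak-* dense subspace separates the points of `S`. -/
theorem eq_zero_of_dense {A : Submodule ℂ (StrongDual ℂ S)}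
    (hA : Dense (StrongDual.toWeakDual '' (A : Set (StrongDual ℂ S)))) {s : S}
    (hs : ∀ f ∈ A, f s = 0) : s = 0 := by
  refine SeparatingDual.eq_zero_of_forall_dual_eq_zero (R := ℂ) fun f => ?_
  refine hA.induction (P := fun f : WeakDual ℂ S => f s = 0) ?_
    (isClosed_eq (WeakDual.eval_continuous s) continuous_const) (StrongDual.toWeakDual f)
  rintro _ ⟨f, hf, rfl⟩
  exact hs f hf

theorem tendsto_toWeakDual_iff {ι : Type*} {l : Filter ι} {e : ι → StrongDual ℂ S}
    {f : StrongDual ℂ S} :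
    Tendsto (fun i => StrongDual.toWeakDual (e i)) l (𝓝 (StrongDual.toWeakDual f)) ↔
      ∀ s, Tendsto (fun i => e i s) l (𝓝 (f s)) :=
  tendsto_iff_forall_eval_tendsto_topDualPairing

/-- If `S*` has a left unit and `A` is dense, then the left unit is the weak-* limit of a bounded
net in `A`, and this net is an approximate identity. -/
theorem hasBoundedLeftWeakApproxIdentity_of_dense {A : Submodule ℂ (StrongDual ℂ S)}
    (hA : 𝒮.IsLeftHopfIdeal A) {u : StrongDual ℂ S} (hu : ∀ f, 𝒮.conv u f = f)
    (hd : Dense (StrongDual.toWeakDual '' (A : Set (StrongDual ℂ S)))) :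
    𝒮.HasBoundedLeftWeakApproxIdentity A := by
  classical
  have hn := norm_le_of_invariant_of_separating A hA.invariant_left hA.invariant_right
    fun s hs => eq_zero_of_dense hd hs
  choose e he heu hes using fun i : Finset S × ℕ =>
    exists_mem_norm_le_of_norming A hn u i.1 (show 0 < 1 / ((i.2 : ℝ) + 1) by positivity)
  refine ⟨Finset S × ℕ, inferInstance, inferInstance, inferInstance, e, he, ⟨‖u‖, heu⟩,
    fun f _ => tendsto_toWeakDual_iff.mpr fun s => ?_⟩
  obtain ⟨r, hr⟩ := 𝒮.exists_conv_apply_eq_left f s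
  have hlim : Tendsto (fun i => e i r) atTop (𝓝 (u r)) := by
    rw [Metric.tendsto_atTop]
    intro ε hε
    obtain ⟨n, hn⟩ := exists_nat_one_div_lt hε
    refine ⟨({r}, n), fun i hi => ?_⟩
    rw [dist_eq_norm]
    refine (hes i r (hi.1 (Finset.mem_singleton_self r))).trans (lt_of_le_of_lt ?_ hn)
    exact one_div_le_one_div_of_le (by positivity) (by exact_mod_cast Nat.succ_le_succ hi.2)
  simp_rw [hr]
  rwa [← hr u, hu] at hlim

/-- A weak-* cluster point of a bounded left approximate identity of `A` is a right identity of
`S*`. Hence `f` is a limit of products `f (e i)`, which belong to `A`, and so `A` is dense; by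
density the cluster point is a left identity as well. -/
theorem unital_and_dense_of_hasBoundedLeftWeakApproxIdentity (h𝒮 : 𝒮.IsSaturated)
    {A : Submodule ℂ (StrongDual ℂ S)} (hA : 𝒮.IsLeftHopfIdeal A)
    (h : 𝒮.HasBoundedLeftWeakApproxIdentity A) :
    𝒮.DualIsUnital ∧ Dense (StrongDual.toWeakDual '' (A : Set (StrongDual ℂ S))) := by
  obtain ⟨ι, _, _, _, e, heA, ⟨M, hM⟩, hef⟩ := h
  let U : Ultrafilter ι := Ultrafilter.of atTop
  have hU : (U : Filter ι) ≤ atTop := Ultrafilter.of_le _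
  obtain ⟨u, -, hu⟩ := (WeakDual.isCompact_closedBall (0 : StrongDual ℂ S) M).ultrafilter_le_nhds
    (U.map fun i => StrongDual.toWeakDual (e i))
    (tendsto_principal.mpr (.of_forall fun i => mem_closedBall_zero_iff.mpr (hM i)))
  obtain ⟨u, rfl⟩ := StrongDual.toWeakDual.surjective u
  have hu : ∀ s, Tendsto (fun i => e i s) U (𝓝 (u s)) := tendsto_toWeakDual_iff.mp hu
  have huA : ∀ f ∈ A, ∀ s, 𝒮.conv u f s = f s := by
    intro f hf s
    obtain ⟨r, hr⟩ := 𝒮.exists_conv_apply_eq_left f s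
    have h1 := (tendsto_toWeakDual_iff.mp (hef f hf) s).mono_left hU
    simp_rw [hr] at h1
    rw [hr]
    exact tendsto_nhds_unique (hu r) h1
  have huR : ∀ f, 𝒮.conv f u = f := by
    intro f
    refine sub_eq_zero.mp (𝒮.eq_zero_of_conv_eq_zero h𝒮 hA fun g hg s => ?_)
    rw [conv_sub_left_apply, conv_assoc_apply, ContinuousLinearMap.ext (huA g hg), sub_self]
  have hd : Dense (StrongDual.toWeakDual '' (A : Set (StrongDual ℂ S))) := by
    intro f
    obtain ⟨f, rfl⟩ := StrongDual.toWeakDual.surjective f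
    refine mem_closure_of_tendsto (f := fun i => StrongDual.toWeakDual (𝒮.conv f (e i)))
      (b := (U : Filter ι)) (tendsto_toWeakDual_iff.mpr fun s => ?_)
      (Eventually.of_forall fun i => ⟨_, hA.left_ideal f _ (heA i), rfl⟩)
    obtain ⟨r, hr⟩ := 𝒮.exists_conv_apply_eq_right f s
    have := hu r
    rw [← hr, huR] at this
    simpa only [hr] using this
  refine ⟨⟨u, fun f => ⟨ContinuousLinearMap.ext fun s => ?_, huR f⟩⟩, hd⟩
  obtain ⟨r, hr⟩ := 𝒮.exists_conv_apply_eq_right u s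
  rw [hr, sub_eq_zero.mp (eq_zero_of_dense hd (s := r - s) fun g hg => by
    rw [map_sub, ← hr, huA g hg, sub_self])]

end HopfCStarAlgebra

end HopfCStar

theorem proposition2p4 {S : Type u} [NonUnitalCStarAlgebra S]
    {H : Type v} [NormedAddCommGroup H] [InnerProductSpace ℂ H] [CompleteSpace H]
    (π : HopfCStar.FaithfulRep S H) (𝒮 : HopfCStar.HopfCStarAlgebra π) (h𝒮 : 𝒮.IsSaturated)
    (A : Submodule ℂ (StrongDual ℂ S)) (hA : 𝒮.IsLeftHopfIdeal A) :
    (𝒮.DualIsUnital ∧ Dense (StrongDual.toWeakDual '' (A : Set (StrongDual ℂ S)))) ↔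
      𝒮.HasBoundedLeftWeakApproxIdentity A :=
  ⟨fun ⟨⟨_, hu⟩, hd⟩ => 𝒮.hasBoundedLeftWeakApproxIdentity_of_dense hA (fun f => (hu f).1) hd,
    𝒮.unital_and_dense_of_hasBoundedLeftWeakApproxIdentity h𝒮 hA⟩
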